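/- Let $(X_{n,i})_{1\le i\le n,\,n\in\mathbb N}$ be a triangular array of random variables on a probability space $(\Omega,\mathcal A,P)$ with values in a complete normed vector space $E$, let $\mathcal G$ be an index set, let $s_n,r_n\ge 1$ be integers, and put $m_n:=\lfloor (n-s_n+1)/r_n\rfloor$. For $1\le i\le m_n$ let $V_{n,i}=(V_{n,i}(g))_{g\in\mathcal G}$ and $\tilde V_{n,i}=(\tilde V_{n,i}(g))_{g\in\mathcal G}$ be real-valued processes; write $V_n,\tilde V_n$ for $V_{n,1},\tilde V_{n,1}$. Let $p_n:=P\{\exists g\in\mathcal G: V_n(g)\ne 0\}$ and assume that $p_n\to 0$ and $p_n>0$ for all large $n$. All expectations and covariances below are assumed to exist for all large $n$ (depending on $g$, $h$). For a finite sequence $\xi_1,\dots,\xi_N$ of random elements and $k\ge 0$ put $$\beta_k(\xi_1,\dots,\xi_N):=\sup_{1\le l\le N-k-1}E\Big[\sup_{B\in\sigma(\xi_{l+k+1},\dots,\xi_N)}\big|P(B\mid \sigma(\xi_1,\dots,\xi_l))-P(B)\big|\Big]$$ (the inner supremum being an essential supremum, and the empty supremum over $l$ being $0$), and let $\beta^X_{n,k}:=\beta_k(X_{n,1},\dots,X_{n,n})$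 and $\beta^{\tilde V}_{n,k}:=\beta_k(\tilde V_{n,1},\dots,\tilde V_{n,m_n})$. Suppose: - (A) $(X_{n,i})_{1\le i\le n}$ is stationary for every $n$, $s_n=o(r_n)$ and $r_n=o(n)$. - (V) For all $n$, $1\le i\le m_n$ and $g\in\mathcal G$, $V_{n,i}(g)$ and $\tilde V_{n,i}(g)$ are measurable with respect to $(X_{n,(i-1)r_n+1},\dots,X_{n,ir_n+s_n-1})$, and $(V_{n,i},\tilde V_{n,i})_{1\le i\le m_n}$ is a stationary sequence of processes. - (M$\tilde V$) $m_n\beta^{\tilde V}_{n,0}\to 0$. - (MX$_k$) $m_n\beta^X_{n,(k-1)r_n-s_n}\to 0$ for some integer $k\ge 2$. - ($\Delta$) With $\Delta_n:=V_n-\tilde V_n$, for all $g\in\mathcal G$, $$E\big[(\Delta_n(g)-E\Delta_n(g))^2\mathbf 1_{\{|\Delta_n(g)-E\Delta_n(g)|\le\sqrt{p_n}\}}\big]=o(p_n/m_n),\qquad P\{|\Delta_n(g)-E\Delta_n(g)|>\sqrt{p_n}\}=o(1/m_n).$$ - (L) For all $g\in\mathcal G$ and $\varepsilon>0$, $E\big[(V_n(g)-EV_n(g))^2\mathbf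 1_{\{|V_n(g)-EV_n(g)|>\varepsilon\sqrt{p_n}\}}\big]=o(p_n/m_n)$. - (D0) For every $n$ with $m_n\ge 1$ the process $V_n$ is separable: there is a countable $T\subset\mathcal G$ such that, almost surely, for every $g\in\mathcal G$ the value $V_n(g)$ lies in the closure of $\{V_n(g'):g'\in T\}$. - (C) There is a function $c:\mathcal G^2\to\mathbb R$ with $\frac{m_n}{p_n}\operatorname{Cov}(V_n(g),V_n(h))\to c(g,h)$ for all $g,h\in\mathcal G$. Then there is a centered Gaussian process $(Z(g))_{g\in\mathcal G}$ with covariance function $c$ such that the finite-dimensional marginal distributions of $$Z_n(g):=\frac1{\sqrt{p_n}}\sum_{i=1}^{m_n}\big(V_{n,i}(g)-E[V_{n,i}(g)]\big),\qquad g\in\mathcal G,$$ converge weakly to those of $Z$; that is, for every finite $I\subset\mathcal G$, $(Z_n(g))_{g\in I}$ converges in distribution to $(Z(g))_{g\in I}$. -/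

import Mathlib

open MeasureTheory ProbabilityTheory Filter Asymptotics Topology
open scoped ENNReal

universe u v w

noncomputable section

namespace BlockArray

/-- Stationarity of the finite sequence `ξ 1, …, ξ N` of random elements: for every lag `h ≤ N`,
`(ξ 1, …, ξ (N - h))` and `(ξ (1 + h), …, ξ N)` have the same distribution. -/
def StationaryUpTo {Ω : Type*} [MeasurableSpace Ω] {S : Type*} [MeasurableSpace S]
    (μ : Measure Ω) (ξ : ℕ → Ω → S) (N : ℕ) : Prop :=
  ∀ h : ℕ, h ≤ N → IdentDistrib
    (fun ω (j : Fin (N - h)) => ξ (j + 1) ω)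
    (fun ω (j : Fin (N - h)) => ξ (j + 1 + h) ω) μ μ

/-- The σ-field generated by `ξ l`, `i ≤ l ≤ j`. -/
abbrev sigmaField {Ω : Type*} {S : Type*} [MeasurableSpace S]
    (ξ : ℕ → Ω → S) (i j : ℕ) : MeasurableSpace Ω :=
  ⨆ l ∈ Set.Icc i j, MeasurableSpace.comap (ξ l) inferInstance

/-- `E [ sup_{B ∈ 𝓑} |P(B | 𝓐) - P(B)| ]`. Conditional probabilities are defined up to null sets
and `𝓑` is in general uncountable, so the supremum is the essential supremum of the family, that
is, its least measurable almost sure upper bound; its expectation is the least expectation of a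
measurable almost sure upper bound `h`. -/
def absReg {Ω : Type*} {mΩ : MeasurableSpace Ω} (μ : Measure Ω)
    (𝓐 𝓑 : MeasurableSpace Ω) : ℝ≥0∞ :=
  ⨅ (h : Ω → ℝ≥0∞) (_ : Measurable[mΩ] h)
    (_ : ∀ B : Set Ω, MeasurableSet[𝓑] B →
      ∀ᵐ ω ∂μ, ENNReal.ofReal |(μ⟦B | 𝓐⟧) ω - μ.real B| ≤ h ω),
    ∫⁻ ω, h ω ∂μ

/-- The β-mixing coefficient at gap `k` of the finite sequence `ξ 1, …, ξ N`:
`sup_{1 ≤ l ≤ N - k - 1} E [ sup_{B ∈ σ(ξ (l+k+1), …, ξ N)} |P(B | σ(ξ 1, …, ξ l)) - P(B)| ]`. -/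
def betaMixing {Ω : Type*} [MeasurableSpace Ω] {S : Type*} [MeasurableSpace S]
    (μ : Measure Ω) (ξ : ℕ → Ω → S) (N k : ℕ) : ℝ≥0∞ :=
  ⨆ l ∈ Set.Icc 1 (N - k - 1), absReg μ (sigmaField ξ 1 l) (sigmaField ξ (l + k + 1) N)

/-- The number of blocks `m_n = ⌊(n - s_n + 1) / r_n⌋` (and `0` if `s_n > n`). -/
def numBlocks (s r : ℕ → ℕ) (n : ℕ) : ℕ := (n + 1 - s n) / r n

section Conditions

variable {Ω : Type u} [MeasurableSpace Ω] {E : Type v} [MeasurableSpace E] {𝓖 : Type w}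

/-- `p_n = P{∃ g, V_n(g) ≠ 0}`, where the generic process `V_n` is represented by `V_{n,1}`. -/
def blockProb (μ : Measure Ω) (V : ℕ → ℕ → 𝓖 → Ω → ℝ) (n : ℕ) : ℝ :=
  μ.real {ω | ∃ g, V n 1 g ω ≠ 0}

/-- `Z_n(g) = p_n^{-1/2} ∑_{i=1}^{m_n} (V_{n,i}(g) - E V_{n,i}(g))`. -/
def empProcess (μ : Measure Ω) (s r : ℕ → ℕ) (V : ℕ → ℕ → 𝓖 → Ω → ℝ)
    (n : ℕ) (g : 𝓖) (ω : Ω) : ℝ :=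
  (√(blockProb μ V n))⁻¹ *
    ∑ i ∈ Finset.Icc 1 (numBlocks s r n), (V n i g ω - ∫ ω', V n i g ω' ∂μ)

/-- Condition (A): row-wise stationarity, and `s_n, r_n` are positive integers with
`s_n = o(r_n)` and `r_n = o(n)`. -/
structure CondA (μ : Measure Ω) (X : ℕ → ℕ → Ω → E) (s r : ℕ → ℕ) : Prop where
  stationary : ∀ n, StationaryUpTo μ (X n) n
  s_pos : ∀ n, 1 ≤ s n
  r_pos : ∀ n, 1 ≤ r n
  s_littleO : (fun n => (s n : ℝ)) =o[atTop] (fun n => (r n : ℝ))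
  r_littleO : (fun n => (r n : ℝ)) =o[atTop] (fun n => (n : ℝ))

/-- Condition (V): for `1 ≤ i ≤ m_n`, the processes `V_{n,i}` and `Ṽ_{n,i}` are measurable
w.r.t. `(X_{n,(i-1)r_n+1}, …, X_{n,i r_n+s_n-1})`, and `(V_{n,i}, Ṽ_{n,i})_{1 ≤ i ≤ m_n}` is a
stationary sequence of processes. -/
structure CondV (μ : Measure Ω) (X : ℕ → ℕ → Ω → E) (s r : ℕ → ℕ)
    (V V' : ℕ → ℕ → 𝓖 → Ω → ℝ) : Prop where
  measurable : ∀ n, ∀ i ∈ Set.Icc 1 (numBlocks s r n), ∀ g,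
    Measurable[sigmaField (X n) ((i - 1) * r n + 1) (i * r n + s n - 1)] (V n i g)
  measurable' : ∀ n, ∀ i ∈ Set.Icc 1 (numBlocks s r n), ∀ g,
    Measurable[sigmaField (X n) ((i - 1) * r n + 1) (i * r n + s n - 1)] (V' n i g)
  stationary : ∀ n, StationaryUpTo μ
    (fun i ω => fun g : 𝓖 => (V n i g ω, V' n i g ω)) (numBlocks s r n)

/-- Condition (MṼ): `m_n β_{n,0}^{Ṽ} → 0`, with the mixing coefficients of the sequence of
processes `Ṽ_{n,1}, …, Ṽ_{n,m_n}`. -/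
def CondMV (μ : Measure Ω) (s r : ℕ → ℕ) (V' : ℕ → ℕ → 𝓖 → Ω → ℝ) : Prop :=
  Tendsto (fun n => (numBlocks s r n : ℝ≥0∞) *
    betaMixing μ (fun i ω => fun g : 𝓖 => V' n i g ω) (numBlocks s r n) 0) atTop (𝓝 0)

/-- Condition (MX_k): `m_n β_{n,(k-1)r_n-s_n}^{X} → 0`. -/
def CondMX (μ : Measure Ω) (X : ℕ → ℕ → Ω → E) (s r : ℕ → ℕ) (k : ℕ) : Prop :=
  Tendsto (fun n => (numBlocks s r n : ℝ≥0∞) *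
    betaMixing μ (X n) n ((k - 1) * r n - s n)) atTop (𝓝 0)

/-- Condition (Δ) on `Δ_n = V_n - Ṽ_n`. The first clause says that the expectations
`E[Δ_n(g)]` in the other two exist. -/
structure CondDelta (μ : Measure Ω) (s r : ℕ → ℕ) (V V' : ℕ → ℕ → 𝓖 → Ω → ℝ) : Prop where
  integrable : ∀ g, ∀ᶠ n in atTop, Integrable (fun ω => V n 1 g ω - V' n 1 g ω) μ
  truncated : ∀ g, (fun n => ∫ ω in {ω | |(V n 1 g ω - V' n 1 g ω)
        - ∫ ω', (V n 1 g ω' - V' n 1 g ω') ∂μ| ≤ √(blockProb μ V n)},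
      ((V n 1 g ω - V' n 1 g ω) - ∫ ω', (V n 1 g ω' - V' n 1 g ω') ∂μ) ^ 2 ∂μ)
    =o[atTop] (fun n => blockProb μ V n / (numBlocks s r n : ℝ))
  tail : ∀ g, (fun n => μ.real {ω | √(blockProb μ V n) < |(V n 1 g ω - V' n 1 g ω)
        - ∫ ω', (V n 1 g ω' - V' n 1 g ω') ∂μ|})
    =o[atTop] (fun n => 1 / (numBlocks s r n : ℝ))

/-- Condition (L), of Lindeberg type. The first clause says that the integrals in the second one
exist. -/
structure CondL (μ : Measure Ω) (s r : ℕ → ℕ) (V : ℕ → ℕ → 𝓖 → Ω → ℝ) : Prop where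
  memLp : ∀ g, ∀ᶠ n in atTop, MemLp (V n 1 g) 2 μ
  lindeberg : ∀ g, ∀ ε : ℝ, 0 < ε →
    (fun n => ∫ ω in {ω | ε * √(blockProb μ V n) < |V n 1 g ω - ∫ ω', V n 1 g ω' ∂μ|},
      (V n 1 g ω - ∫ ω', V n 1 g ω' ∂μ) ^ 2 ∂μ)
    =o[atTop] (fun n => blockProb μ V n / (numBlocks s r n : ℝ))

/-- Condition (D0): separability of `V_n` (for all `n` for which there is a block). There is a
countable set `T` of indices such that, almost surely, every value `V_n(g)` is a limit of values
of `V_n` on `T`. No topology on the index set is given; this is separability for the indiscrete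
one, and it is implied by separability for any other topology. -/
def CondD0 (μ : Measure Ω) (s r : ℕ → ℕ) (V : ℕ → ℕ → 𝓖 → Ω → ℝ) : Prop :=
  ∀ n, 1 ≤ numBlocks s r n → ∃ T : Set 𝓖, T.Countable ∧
    ∀ᵐ ω ∂μ, ∀ g, V n 1 g ω ∈ closure ((fun g' => V n 1 g' ω) '' T)

/-- Condition (C) with limit function `c`: `(m_n / p_n) Cov(V_n(g), V_n(h)) → c(g, h)`. The first
clause says that the covariances exist. -/
structure CondC (μ : Measure Ω) (s r : ℕ → ℕ) (V : ℕ → ℕ → 𝓖 → Ω → ℝ) (c : 𝓖 → 𝓖 → ℝ) :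
    Prop where
  memLp : ∀ g, ∀ᶠ n in atTop, MemLp (V n 1 g) 2 μ
  tendsto : ∀ g h, Tendsto (fun n => (numBlocks s r n : ℝ) / blockProb μ V n *
    cov[V n 1 g, V n 1 h; μ]) atTop (𝓝 (c g h))

end Conditions

end BlockArray

end

/-! For fixed coefficients on a finite index set, let `U n i` be the linear combination of the
normalized contributions of block `i`. It is split as `(U - R) + R`, where `U - R` depends on Ṽ
alone and `R` is the normalized difference Δ, shifted by a constant. The two sums are handled by
different mixing conditions. All comparisons go through the characters exp(ix): they have modulus
one, so the errors made in the factors of a product simply add up.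

The sum of `U - R`. Mixing of Ṽ at gap 0 lets the expectation of the product of characters factorize
up to 16 m β → 0 (`ofReal_norm_integral_prod_sub_le_betaMixing`). By (Δ), `R` agrees, off an event
of probability o(1/m), with a centered `T` such that E T² = o(1/m). Replacing `U - R` by `U`
therefore moves a single characteristic function by o(1/m) and leaves its m-th power unchanged in
the limit. By (C) and (L), E exp(iU) = 1 - v/(2m) + o(1/m), and the power tends to exp(-v/2).

The sum of `R`. Neighbouring blocks of X overlap, so the blocks are sorted into residue classes
modulo k, within which mixing of X applies (`ofReal_norm_integral_prod_residue_sub_le_betaMixing`).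
The character of each class sum then has mean tending to 1. Being unimodular, it tends to 1 in L¹
(`tendsto_integral_norm_sub_one`), and L¹ convergence survives multiplication over the k dependent
classes. Hence the sum of `R` can be dropped, which gives `tendsto_integral_expI_sum`.

Lévy's continuity theorem turns the limits for all coefficients into finite-dimensional convergence.
The kernel c is positive semidefinite as a limit of covariances, so the Gaussian marginals form a
projective family, and Kolmogorov's extension theorem supplies Z. -/

namespace BlockArray

/-! ### Kolmogorov's extension theorem for real-valued processes. -/

section Kolmogorov

variable {ι : Type*} {Q : ∀ J : Finset ι, Measure (J → ℝ)}

/-- A decreasing sequence of measurable cylinders with empty intersection has vanishing content. -/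
lemma tendsto_projectiveFamilyContent_zero [∀ J, IsFiniteMeasure (Q J)]
    (hQ : IsProjectiveMeasureFamily (α := fun _ : ι => ℝ) Q) {A : ℕ → Set (ι → ℝ)}
    (hA : ∀ n, A n ∈ measurableCylinders (fun _ : ι => ℝ)) (hanti : Antitone A)
    (hinter : ⋂ n, A n = ∅) :
    Tendsto (fun n => projectiveFamilyContent hQ (A n)) atTop (𝓝 0) := by
  have hmono : Antitone (fun n => projectiveFamilyContent hQ (A n)) := fun i j hij =>
    projectiveFamilyContent_mono hQ (hA j) (hA i) (hanti hij)
  suffices hinf : ⨅ n, projectiveFamilyContent hQ (A n) = 0 by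
    rw [← hinf]; exact tendsto_atTop_iInf hmono
  by_contra hne
  set ε := ⨅ n, projectiveFamilyContent hQ (A n) with hε
  have hεA n : ε ≤ projectiveFamilyContent hQ (A n) := iInf_le _ n
  have hAcyl n : ∃ s : Finset ι, ∃ S : Set (s → ℝ), MeasurableSet S ∧ A n = cylinder s S := by
    simpa [mem_measurableCylinders] using hA n
  choose s S hS hAS using hAcyl
  -- The total content `∑ δ n` lost when passing to compact bases stays below the infimum ε, which
  -- is assumed positive.
  obtain ⟨δ, hδpos, hδsum⟩ := ENNReal.exists_pos_sum_of_countable' hne ℕ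
  have hK n : ∃ K ⊆ S n, IsCompact K ∧ Q (s n) (S n \ K) < δ n :=
    (hS n).exists_isCompact_sdiff_lt (measure_ne_top _ _) (hδpos n).ne'
  choose K hKS hKc hKδ using hK
  have hBcyl n : cylinder (s n) (K n) ∈ measurableCylinders (fun _ : ι => ℝ) :=
    cylinder_mem_measurableCylinders _ _ (hKc n).isClosed.measurableSet
  have hne' n : (⋂ k ≤ n, cylinder (α := fun _ : ι => ℝ) (s k) (K k)).Nonempty := by
    by_contra hemp
    rw [Set.not_nonempty_iff_eq_empty] at hemp
    have hsub : A n ⊆ ⋃ k ≤ n, (A k \ cylinder (s k) (K k)) := by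
      intro x hx
      have : x ∉ ⋂ k ≤ n, cylinder (α := fun _ : ι => ℝ) (s k) (K k) := by simp [hemp]
      simp only [Set.mem_iInter, not_forall] at this
      obtain ⟨k, hk, hxk⟩ := this
      exact Set.mem_iUnion₂.2 ⟨k, hk, hanti hk hx, hxk⟩
    have hdm k : A k \ cylinder (s k) (K k) ∈ measurableCylinders (fun _ : ι => ℝ) :=
      sdiff_mem_measurableCylinders (hA k) (hBcyl k)
    have h1 : projectiveFamilyContent hQ (A n) ≤
        ∑ k ∈ Finset.range (n + 1), projectiveFamilyContent hQ (A k \ cylinder (s k) (K k)) := by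
      refine le_trans ?_ (projectiveFamilyContent_iUnion_le hQ hdm n)
      refine projectiveFamilyContent_mono hQ (hA n) ?_ hsub
      exact isSetRing_measurableCylinders.iUnion_le_mem hdm n
    have h2 k : projectiveFamilyContent hQ (A k \ cylinder (s k) (K k)) ≤ δ k := by
      rw [hAS k, projectiveFamilyContent_congr hQ _ (I := s k) (S := S k \ K k) _
        ((hS k).diff (hKc k).isClosed.measurableSet)]
      · exact (hKδ k).le
      · simp [cylinder, Set.preimage_sdiff]
    have h3 : projectiveFamilyContent hQ (A n) ≤ ∑' k, δ k :=
      h1.trans ((Finset.sum_le_sum fun k _ => h2 k).trans (ENNReal.sum_le_tsum _))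
    exact absurd ((hεA n).trans h3) (not_le.2 hδsum)
  choose x hx using hne'
  -- A free ultrafilter replaces a diagonal extraction: it makes all restrictions of `x m` converge
  -- at once, although `x m` is controlled by `K n` only for `m ≥ n`.
  let 𝒰 : Ultrafilter ℕ := hyperfilter ℕ
  have hmem n : ∀ᶠ m in (𝒰 : Filter ℕ), (s n).restrict (x m) ∈ K n := by
    have : ∀ᶠ m in atTop, (s n).restrict (x m) ∈ K n := by
      filter_upwards [eventually_ge_atTop n] with m hm
      exact Set.mem_iInter₂.1 (hx m) n hm
    exact (Nat.hyperfilter_le_atTop) this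
  have hlim n : ∃ y ∈ K n, Tendsto (fun m => (s n).restrict (x m)) (𝒰 : Filter ℕ) (𝓝 y) := by
    obtain ⟨y, hy, hle⟩ := (hKc n).ultrafilter_le_nhds (𝒰.map fun m => (s n).restrict (x m))
      (le_principal_iff.2 (hmem n))
    exact ⟨y, hy, hle⟩
  choose y hyK hy using hlim
  -- Coordinates outside every `s n` may get a meaningless limit; no cylinder `A n` sees them.
  let z : ι → ℝ := fun i => limUnder (𝒰 : Filter ℕ) fun m => x m i
  have hz n : (s n).restrict z = y n := by
    funext i
    exact ((tendsto_pi_nhds.1 (hy n)) i).limUnder_eq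
  have : z ∈ ⋂ n, A n := by
    refine Set.mem_iInter.2 fun n => ?_
    rw [hAS n, mem_cylinder, hz n]
    exact hKS n (hyK n)
  simp [hinter] at this

/-- **Kolmogorov's extension theorem** for real-valued processes. -/
theorem exists_isProjectiveLimit [∀ J, IsFiniteMeasure (Q J)]
    (hQ : IsProjectiveMeasureFamily (α := fun _ : ι => ℝ) Q) :
    ∃ P : Measure (ι → ℝ), IsProjectiveLimit P Q := by
  have hsub : (projectiveFamilyContent hQ).IsSigmaSubadditive := by
    refine isSigmaSubadditive_of_addContent_iUnion_eq_tsum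
      isSetRing_measurableCylinders fun f hf hf_Union hf' => ?_
    exact addContent_iUnion_eq_sum_of_tendsto_zero isSetRing_measurableCylinders _
      (fun s hs => projectiveFamilyContent_ne_top _)
      (fun _ => tendsto_projectiveFamilyContent_zero hQ) hf hf_Union hf'
  refine ⟨(projectiveFamilyContent hQ).measure isSetSemiring_measurableCylinders
    generateFrom_measurableCylinders.ge hsub, fun I => ?_⟩
  ext t ht
  rw [Measure.map_apply (Finset.measurable_restrict I) ht, AddContent.measure_eq,
    ← cylinder, projectiveFamilyContent_cylinder hQ ht]
  · exact generateFrom_measurableCylinders.symm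
  · exact cylinder_mem_measurableCylinders _ _ ht

end Kolmogorov

/-! ### Gaussian processes with a given positive semidefinite covariance. -/

section GaussianProcess

variable {ι : Type w} (c : ι → ι → ℝ)

/-- The restriction of a kernel to a finite set of indices, as a matrix. -/
def kernelMatrix (I : Finset ι) : Matrix I I ℝ := Matrix.of fun i j => c i j

open scoped Classical in
/-- The centered Gaussian law on `I → ℝ` with covariance `c`. -/
noncomputable def gaussianFamily (I : Finset ι) : Measure (I → ℝ) :=
  (multivariateGaussian 0 (kernelMatrix c I)).map (MeasurableEquiv.toLp 2 (I → ℝ)).symm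

instance isGaussian_gaussianFamily (I : Finset ι) : IsGaussian (gaussianFamily c I) := by
  rw [gaussianFamily,
    show ⇑(MeasurableEquiv.toLp 2 (I → ℝ)).symm = ⇑(EuclideanSpace.equiv I ℝ) from rfl]
  infer_instance

variable {c}

lemma isProjectiveMeasureFamily_gaussianFamily (hc : ∀ I, (kernelMatrix c I).PosSemidef) :
    IsProjectiveMeasureFamily (α := fun _ : ι => ℝ) (gaussianFamily c) := by
  classical
  intro I J hJI
  have h1 : MeasurePreserving (WithLp.ofLp (p := 2)) (multivariateGaussian 0 (kernelMatrix c J))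
      (gaussianFamily c J) := ⟨by fun_prop, rfl⟩
  have h2 := measurePreserving_restrict₂_multivariateGaussian (μ := 0) (hc I) hJI
  have h3 : gaussianFamily c I = (multivariateGaussian 0 (kernelMatrix c I)).map
    (MeasurableEquiv.toLp 2 (I → ℝ)).symm := rfl
  rw [h3, Measure.map_map]
  · have : (Finset.restrict₂ (π := fun _ ↦ ℝ) hJI ∘ (MeasurableEquiv.toLp 2 (I → ℝ)).symm) =
        WithLp.ofLp ∘ (EuclideanSpace.restrict₂ hJI) := by ext; simp
    rw [this]
    have h4 : EuclideanSpace.restrict₂ hJI (0 : EuclideanSpace ℝ I) = 0 := map_zero _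
    rw [h4] at h2
    exact ((h1.comp h2).map_eq).symm
  · exact Finset.measurable_restrict₂ _
  · fun_prop

/-- A positive semidefinite kernel is the covariance function of a centered Gaussian process, with
the canonical process on `ι → ℝ`. -/
theorem exists_isGaussianProcess (hc : ∀ I, (kernelMatrix c I).PosSemidef) :
    ∃ P : Measure (ι → ℝ), IsProbabilityMeasure P ∧
      IsGaussianProcess (fun g (ω : ι → ℝ) => ω g) P ∧ (∀ g, ∫ ω, ω g ∂P = 0) ∧
      (∀ g h, cov[fun ω : ι → ℝ => ω g, fun ω => ω h; P] = c g h) ∧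
      ∀ I : Finset ι, P.map I.restrict = gaussianFamily c I := by
  classical
  obtain ⟨P, hP⟩ := exists_isProjectiveLimit (isProjectiveMeasureFamily_gaussianFamily hc)
  have h3 (I : Finset ι) : gaussianFamily c I = (multivariateGaussian 0 (kernelMatrix c I)).map
    (MeasurableEquiv.toLp 2 (I → ℝ)).symm := rfl
  refine ⟨P, hP.isProbabilityMeasure, ⟨fun I => ⟨?_⟩⟩, fun g => ?_, fun g h => ?_, hP⟩
  · exact (hP I).symm ▸ isGaussian_gaussianFamily c I
  · have hg : g ∈ ({g} : Finset ι) := by simp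
    have h1 : ∫ ω, ω g ∂P = ∫ x, x ⟨g, hg⟩ ∂(gaussianFamily c {g}) := by
      rw [← hP {g}, integral_map (Finset.measurable_restrict _).aemeasurable
        (by exact (measurable_pi_apply _).aestronglyMeasurable)]
      rfl
    rw [h1, h3, integral_map_equiv]
    have h2 := integral_id_multivariateGaussian (μ := 0) (S := kernelMatrix c {g})
    have h4 := ContinuousLinearMap.integral_comp_id_comm
      (μ := multivariateGaussian 0 (kernelMatrix c {g})) IsGaussian.integrable_id
      (EuclideanSpace.proj (𝕜 := ℝ) (⟨g, hg⟩ : ({g} : Finset ι)))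
    rw [h2, map_zero] at h4
    exact h4
  · have hg : g ∈ ({g, h} : Finset ι) := by simp
    have hh : h ∈ ({g, h} : Finset ι) := by simp
    have h1 : cov[fun ω : ι → ℝ => ω g, fun ω => ω h; P] =
        cov[fun x => x ⟨g, hg⟩, fun x => x ⟨h, hh⟩; gaussianFamily c {g, h}] := by
      have h2 := covariance_map (μ := P)
        (Z := Finset.restrict (π := fun _ : ι => ℝ) {g, h})
        (X := fun x : ({g, h} : Finset ι) → ℝ => x ⟨g, hg⟩)
        (Y := fun x : ({g, h} : Finset ι) → ℝ => x ⟨h, hh⟩)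
        (measurable_pi_apply _).aestronglyMeasurable (measurable_pi_apply _).aestronglyMeasurable
        (Finset.measurable_restrict _).aemeasurable
      rw [hP {g, h}] at h2
      exact h2.symm
    rw [h1, h3, covariance_map_equiv]
    exact covariance_eval_multivariateGaussian (hc _) _ _

end GaussianProcess

/-! ### Covariance inequalities for absolutely regular σ-fields. -/

section Mixing

lemma re_integral {Ω : Type*} {mΩ : MeasurableSpace Ω} {μ : Measure Ω} {F : Ω → ℂ}
    (hF : Integrable F μ) : (∫ ω, F ω ∂μ).re = ∫ ω, (F ω).re ∂μ :=
  (integral_re hF).symm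

lemma im_integral {Ω : Type*} {mΩ : MeasurableSpace Ω} {μ : Measure Ω} {F : Ω → ℂ}
    (hF : Integrable F μ) : (∫ ω, F ω ∂μ).im = ∫ ω, (F ω).im ∂μ :=
  (integral_im hF).symm

variable {Ω : Type*} {mΩ : MeasurableSpace Ω} {μ : Measure Ω} [IsProbabilityMeasure μ]
  {𝓐 𝓑 : MeasurableSpace Ω}

/-- The dependence between two σ-fields measured on indicators is bounded by `absReg`. -/
lemma abs_measureReal_inter_sub_le (h𝓐 : 𝓐 ≤ mΩ) (h𝓑 : 𝓑 ≤ mΩ) {A B : Set Ω}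
    (hA : MeasurableSet[𝓐] A) (hB : MeasurableSet[𝓑] B) :
    ENNReal.ofReal |μ.real (A ∩ B) - μ.real A * μ.real B| ≤ absReg μ 𝓐 𝓑 := by
  refine le_iInf fun h => le_iInf fun hh => le_iInf fun hle => ?_
  have hB' := h𝓑 _ hB
  have hA' := h𝓐 _ hA
  have hind : Integrable (B.indicator (fun _ => (1 : ℝ))) μ :=
    (integrable_const 1).indicator hB'
  have h1 : ∫ ω in A, ((μ⟦B | 𝓐⟧) ω - μ.real B) ∂μ = μ.real (A ∩ B) - μ.real A * μ.real B := by
    rw [integral_sub integrable_condExp.integrableOn (integrable_const _),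
      setIntegral_condExp h𝓐 hind hA, setIntegral_indicator hB']
    simp
  rw [← h1]
  calc ENNReal.ofReal |∫ ω in A, ((μ⟦B | 𝓐⟧) ω - μ.real B) ∂μ|
      = ‖∫ ω in A, ((μ⟦B | 𝓐⟧) ω - μ.real B) ∂μ‖ₑ := by
        rw [← Real.norm_eq_abs, ofReal_norm]
    _ ≤ ∫⁻ ω in A, ‖(μ⟦B | 𝓐⟧) ω - μ.real B‖ₑ ∂μ := enorm_integral_le_lintegral_enorm _
    _ ≤ ∫⁻ ω, ‖(μ⟦B | 𝓐⟧) ω - μ.real B‖ₑ ∂μ := setLIntegral_le_lintegral _ _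
    _ ≤ ∫⁻ ω, h ω ∂μ := by
        refine lintegral_mono_ae ?_
        filter_upwards [hle B hB] with ω hω
        rwa [← ofReal_norm, Real.norm_eq_abs]

/-- Among the measurable `f` with values in `[0, 1]`, the integral `∫ f Y` is maximal at an
indicator. -/
lemma exists_measurableSet_integral_mul_le (h𝓐 : 𝓐 ≤ mΩ) {f Y : Ω → ℝ}
    (hf : Measurable[𝓐] f) (hf0 : ∀ ω, 0 ≤ f ω) (hf1 : ∀ ω, f ω ≤ 1) (hY : Integrable Y μ) :
    ∃ A, MeasurableSet[𝓐] A ∧ ∫ ω, f ω * Y ω ∂μ ≤ ∫ ω in A, Y ω ∂μ := by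
  have hD : StronglyMeasurable[𝓐] (μ[Y | 𝓐]) := stronglyMeasurable_condExp
  -- `f` enters the integral only through `f * μ[Y | 𝓐]`, which is pointwise largest when `f` is the
  -- indicator of the set where the conditional expectation is positive.
  have hA : MeasurableSet[𝓐] {ω | 0 < (μ[Y | 𝓐]) ω} :=
    hD.measurable measurableSet_Ioi
  have hfb : ∀ᵐ ω ∂μ, ‖f ω‖ ≤ 1 := ae_of_all _ fun ω => by
    rw [Real.norm_eq_abs, abs_of_nonneg (hf0 ω)]; exact hf1 ω
  have hfm : AEStronglyMeasurable[mΩ] f μ := (hf.mono h𝓐 le_rfl).aestronglyMeasurable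
  have hfY : Integrable (fun ω => f ω * Y ω) μ := hY.bdd_mul (c := 1) hfm hfb
  have hfD : Integrable (fun ω => f ω * (μ[Y | 𝓐]) ω) μ :=
    integrable_condExp.bdd_mul (c := 1) hfm hfb
  refine ⟨_, hA, ?_⟩
  rw [← setIntegral_condExp h𝓐 hY hA, ← integral_indicator (h𝓐 _ hA)]
  have h1 : μ[fun ω => f ω * Y ω | 𝓐] =ᵐ[μ] fun ω => f ω * (μ[Y | 𝓐]) ω :=
    condExp_mul_of_stronglyMeasurable_left hf.stronglyMeasurable hfY hY
  rw [← integral_condExp h𝓐, integral_congr_ae h1]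
  refine integral_mono hfD (integrable_condExp.indicator (h𝓐 _ hA)) fun ω => ?_
  by_cases hω : 0 < (μ[Y | 𝓐]) ω
  · rw [Set.indicator_of_mem (by exact hω)]
    exact mul_le_of_le_one_left hω.le (hf1 ω)
  · rw [Set.indicator_of_notMem (by exact hω)]
    exact mul_nonpos_of_nonneg_of_nonpos (hf0 ω) (not_lt.1 hω)

/-- The covariance of `[0, 1]`-valued random variables is bounded by `absReg`. -/
lemma integral_mul_sub_le_absReg (h𝓐 : 𝓐 ≤ mΩ) (h𝓑 : 𝓑 ≤ mΩ) {f g : Ω → ℝ}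
    (hf : Measurable[𝓐] f) (hf0 : ∀ ω, 0 ≤ f ω) (hf1 : ∀ ω, f ω ≤ 1)
    (hg : Measurable[𝓑] g) (hg0 : ∀ ω, 0 ≤ g ω) (hg1 : ∀ ω, g ω ≤ 1) :
    ENNReal.ofReal (∫ ω, f ω * g ω ∂μ - (∫ ω, f ω ∂μ) * ∫ ω, g ω ∂μ) ≤ absReg μ 𝓐 𝓑 := by
  have hfb : ∀ᵐ ω ∂μ, ‖f ω‖ ≤ 1 := ae_of_all _ fun ω => by
    rw [Real.norm_eq_abs, abs_of_nonneg (hf0 ω)]; exact hf1 ω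
  have hgb : ∀ᵐ ω ∂μ, ‖g ω‖ ≤ 1 := ae_of_all _ fun ω => by
    rw [Real.norm_eq_abs, abs_of_nonneg (hg0 ω)]; exact hg1 ω
  have hfm : AEStronglyMeasurable[mΩ] f μ := (hf.mono h𝓐 le_rfl).aestronglyMeasurable
  have hfi : Integrable f μ := .of_bound hfm 1 hfb
  have hgi : Integrable g μ := .of_bound (hg.mono h𝓑 le_rfl).aestronglyMeasurable 1 hgb
  have hfg : Integrable (fun ω => f ω * g ω) μ := hgi.bdd_mul (c := 1) hfm hfb
  -- The extremal principle is used twice: `f` becomes the indicator of `A` with `g` fixed, then `g`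
  -- becomes the indicator of `B` with `A` fixed. Neither replacement lowers the signed covariance.
  obtain ⟨A, hA, hAle⟩ := exists_measurableSet_integral_mul_le (μ := μ) h𝓐 hf hf0 hf1
    (Y := fun ω => g ω - ∫ ω', g ω' ∂μ) (hgi.sub (integrable_const _))
  have hA' := h𝓐 _ hA
  have hiA : Integrable (A.indicator (fun _ => (1 : ℝ))) μ := (integrable_const 1).indicator hA'
  obtain ⟨B, hB, hBle⟩ := exists_measurableSet_integral_mul_le (μ := μ) h𝓑 hg hg0 hg1
    (Y := fun ω => A.indicator (fun _ => (1 : ℝ)) ω - μ.real A) (hiA.sub (integrable_const _))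
  have hB' := h𝓑 _ hB
  refine le_trans (ENNReal.ofReal_le_ofReal ?_) (abs_measureReal_inter_sub_le h𝓐 h𝓑 hA hB)
  have e1 : ∫ ω, f ω * (g ω - ∫ ω', g ω' ∂μ) ∂μ
      = ∫ ω, f ω * g ω ∂μ - (∫ ω, f ω ∂μ) * ∫ ω, g ω ∂μ := by
    simp_rw [mul_sub]
    rw [integral_sub hfg (hfi.mul_const _), integral_mul_const]
  have e2 : ∫ ω in A, (g ω - ∫ ω', g ω' ∂μ) ∂μ
      = ∫ ω in A, g ω ∂μ - μ.real A * ∫ ω, g ω ∂μ := by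
    rw [integral_sub hgi.integrableOn (integrable_const _)]
    simp
  have e3 : ∫ ω, g ω * (A.indicator (fun _ => (1 : ℝ)) ω - μ.real A) ∂μ
      = ∫ ω in A, g ω ∂μ - μ.real A * ∫ ω, g ω ∂μ := by
    have : ∀ ω, g ω * (A.indicator (fun _ => (1 : ℝ)) ω - μ.real A)
        = A.indicator g ω - g ω * μ.real A := fun ω => by
      by_cases h : ω ∈ A <;> simp [h, mul_sub]
    simp_rw [this]
    rw [integral_sub (hgi.indicator hA') (hgi.mul_const _), integral_indicator hA',
      integral_mul_const, mul_comm]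
  have e4 : ∫ ω in B, (A.indicator (fun _ => (1 : ℝ)) ω - μ.real A) ∂μ
      = μ.real (A ∩ B) - μ.real A * μ.real B := by
    rw [integral_sub hiA.integrableOn (integrable_const _), setIntegral_indicator hA',
      Set.inter_comm]
    simp [mul_comm]
  rw [e1, e2] at hAle
  rw [e3, e4] at hBle
  exact (hAle.trans hBle).trans (le_abs_self _)

/-- The covariance of `[-1, 1]`-valued random variables is bounded by `4 * absReg`. -/
lemma abs_integral_mul_sub_le_absReg (h𝓐 : 𝓐 ≤ mΩ) (h𝓑 : 𝓑 ≤ mΩ) {f g : Ω → ℝ}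
    (hf : Measurable[𝓐] f) (hf1 : ∀ ω, |f ω| ≤ 1)
    (hg : Measurable[𝓑] g) (hg1 : ∀ ω, |g ω| ≤ 1) :
    ENNReal.ofReal |∫ ω, f ω * g ω ∂μ - (∫ ω, f ω ∂μ) * ∫ ω, g ω ∂μ| ≤ 4 * absReg μ 𝓐 𝓑 := by
  have hfm : AEStronglyMeasurable[mΩ] f μ := (hf.mono h𝓐 le_rfl).aestronglyMeasurable
  have hfi : Integrable f μ := .of_bound hfm 1 (ae_of_all _ hf1)
  have hgi : Integrable g μ := .of_bound (hg.mono h𝓑 le_rfl).aestronglyMeasurable 1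
    (ae_of_all _ hg1)
  have hfg : Integrable (fun ω => f ω * g ω) μ := hgi.bdd_mul (c := 1) hfm (ae_of_all _ hf1)
  -- The maps x ↦ (1 ± x)/2 send [-1, 1] to [0, 1] and divide the covariance by 4; the sign ε
  -- recovers the absolute value.
  have key : ∀ ε : ℝ, |ε| = 1 → ENNReal.ofReal
      (ε * (∫ ω, f ω * g ω ∂μ - (∫ ω, f ω ∂μ) * ∫ ω, g ω ∂μ)) ≤ 4 * absReg μ 𝓐 𝓑 := by
    intro ε hε
    have hε1 : ∀ ω, |ε * f ω| ≤ 1 := fun ω => by rw [abs_mul, hε, one_mul]; exact hf1 ω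
    have h := integral_mul_sub_le_absReg (μ := μ) h𝓐 h𝓑
      (f := fun ω => (1 + ε * f ω) / 2) (g := fun ω => (1 + g ω) / 2)
      (((hf.const_mul ε).const_add 1).div_const 2)
      (fun ω => by linarith [(abs_le.1 (hε1 ω)).1]) (fun ω => by linarith [(abs_le.1 (hε1 ω)).2])
      ((hg.const_add 1).div_const 2)
      (fun ω => by linarith [(abs_le.1 (hg1 ω)).1]) (fun ω => by linarith [(abs_le.1 (hg1 ω)).2])
    have e1 : ∫ ω, (1 + ε * f ω) / 2 ∂μ = (1 + ε * ∫ ω, f ω ∂μ) / 2 := by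
      rw [integral_div, integral_add (integrable_const _) (hfi.const_mul _), integral_const_mul]
      simp
    have e2 : ∫ ω, (1 + g ω) / 2 ∂μ = (1 + ∫ ω, g ω ∂μ) / 2 := by
      rw [integral_div, integral_add (integrable_const _) hgi]
      simp
    have e3 : ∫ ω, (1 + ε * f ω) / 2 * ((1 + g ω) / 2) ∂μ
        = (1 + ε * ∫ ω, f ω ∂μ + (∫ ω, g ω ∂μ + ε * ∫ ω, f ω * g ω ∂μ)) / 4 := by
      have : ∀ ω, (1 + ε * f ω) / 2 * ((1 + g ω) / 2)
        = ((1 + ε * f ω) + (g ω + ε * (f ω * g ω))) / 4 := fun ω => by ring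
      simp_rw [this]
      have i1 : Integrable (fun ω => 1 + ε * f ω) μ := (integrable_const _).add (hfi.const_mul _)
      have i2 : Integrable (fun ω => g ω + ε * (f ω * g ω)) μ := hgi.add (hfg.const_mul _)
      rw [integral_div, integral_add i1 i2, integral_add (integrable_const _) (hfi.const_mul _),
        integral_add hgi (hfg.const_mul _), integral_const_mul, integral_const_mul]
      simp
    rw [e1, e2, e3] at h
    calc ENNReal.ofReal (ε * (∫ ω, f ω * g ω ∂μ - (∫ ω, f ω ∂μ) * ∫ ω, g ω ∂μ))
        = ENNReal.ofReal (4 * ((1 + ε * ∫ ω, f ω ∂μ + (∫ ω, g ω ∂μ + ε * ∫ ω, f ω * g ω ∂μ)) / 4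
          - (1 + ε * ∫ ω, f ω ∂μ) / 2 * ((1 + ∫ ω, g ω ∂μ) / 2))) := by congr 1; ring
      _ ≤ 4 * absReg μ 𝓐 𝓑 := by
        rw [ENNReal.ofReal_mul (by norm_num), ENNReal.ofReal_ofNat]
        gcongr
  rcases abs_choice (∫ ω, f ω * g ω ∂μ - (∫ ω, f ω ∂μ) * ∫ ω, g ω ∂μ) with h | h
  · rw [h]; simpa using key 1 (by simp)
  · rw [h]; simpa using key (-1) (by simp)

/-- The covariance of complex random variables of modulus at most `1` is bounded by
`16 * absReg`. -/
lemma norm_integral_mul_sub_le_absReg (h𝓐 : 𝓐 ≤ mΩ) (h𝓑 : 𝓑 ≤ mΩ) {f g : Ω → ℂ}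
    (hf : Measurable[𝓐] f) (hf1 : ∀ ω, ‖f ω‖ ≤ 1)
    (hg : Measurable[𝓑] g) (hg1 : ∀ ω, ‖g ω‖ ≤ 1) :
    ENNReal.ofReal ‖∫ ω, f ω * g ω ∂μ - (∫ ω, f ω ∂μ) * ∫ ω, g ω ∂μ‖
      ≤ 16 * absReg μ 𝓐 𝓑 := by
  have hfm : AEStronglyMeasurable[mΩ] f μ := (hf.mono h𝓐 le_rfl).aestronglyMeasurable
  have hfi : Integrable f μ := .of_bound hfm 1 (ae_of_all _ hf1)
  have hgi : Integrable g μ := .of_bound (hg.mono h𝓑 le_rfl).aestronglyMeasurable 1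
    (ae_of_all _ hg1)
  have hfg : Integrable (fun ω => f ω * g ω) μ := hgi.bdd_mul (c := 1) hfm (ae_of_all _ hf1)
  have hfr : Measurable[𝓐] fun ω => (f ω).re := Complex.measurable_re.comp hf
  have hfim : Measurable[𝓐] fun ω => (f ω).im := Complex.measurable_im.comp hf
  have hgr : Measurable[𝓑] fun ω => (g ω).re := Complex.measurable_re.comp hg
  have hgim : Measurable[𝓑] fun ω => (g ω).im := Complex.measurable_im.comp hg
  have bfr : ∀ ω, |(f ω).re| ≤ 1 := fun ω => (Complex.abs_re_le_norm _).trans (hf1 ω)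
  have bfi : ∀ ω, |(f ω).im| ≤ 1 := fun ω => (Complex.abs_im_le_norm _).trans (hf1 ω)
  have bgr : ∀ ω, |(g ω).re| ≤ 1 := fun ω => (Complex.abs_re_le_norm _).trans (hg1 ω)
  have bgi : ∀ ω, |(g ω).im| ≤ 1 := fun ω => (Complex.abs_im_le_norm _).trans (hg1 ω)
  have k1 := abs_integral_mul_sub_le_absReg (μ := μ) h𝓐 h𝓑 hfr bfr hgr bgr
  have k2 := abs_integral_mul_sub_le_absReg (μ := μ) h𝓐 h𝓑 hfim bfi hgim bgi
  have k3 := abs_integral_mul_sub_le_absReg (μ := μ) h𝓐 h𝓑 hfr bfr hgim bgi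
  have k4 := abs_integral_mul_sub_le_absReg (μ := μ) h𝓐 h𝓑 hfim bfi hgr bgr
  have irr : ∀ {a b : Ω → ℝ}, Measurable[𝓐] a → (∀ ω, |a ω| ≤ 1) → Measurable[𝓑] b →
      (∀ ω, |b ω| ≤ 1) → Integrable (fun ω => a ω * b ω) μ := fun {a b} ha ha1 hb hb1 =>
    (Integrable.of_bound (hb.mono h𝓑 le_rfl).aestronglyMeasurable 1 (ae_of_all _ hb1)).bdd_mul
      (c := 1) (ha.mono h𝓐 le_rfl).aestronglyMeasurable (ae_of_all _ ha1)
  -- Real and imaginary part each combine two real covariances, so four of them, each at most `4 *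
  -- absReg`, account for the constant 16.
  have hre : (∫ ω, f ω * g ω ∂μ - (∫ ω, f ω ∂μ) * ∫ ω, g ω ∂μ).re
      = (∫ ω, (f ω).re * (g ω).re ∂μ - (∫ ω, (f ω).re ∂μ) * ∫ ω, (g ω).re ∂μ)
      - (∫ ω, (f ω).im * (g ω).im ∂μ - (∫ ω, (f ω).im ∂μ) * ∫ ω, (g ω).im ∂μ) := by
    rw [Complex.sub_re, Complex.mul_re, re_integral hfg, re_integral hfi, re_integral hgi,
      im_integral hfi, im_integral hgi]
    simp_rw [Complex.mul_re]
    rw [integral_sub (irr hfr bfr hgr bgr) (irr hfim bfi hgim bgi)]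
    ring
  have him : (∫ ω, f ω * g ω ∂μ - (∫ ω, f ω ∂μ) * ∫ ω, g ω ∂μ).im
      = (∫ ω, (f ω).re * (g ω).im ∂μ - (∫ ω, (f ω).re ∂μ) * ∫ ω, (g ω).im ∂μ)
      + (∫ ω, (f ω).im * (g ω).re ∂μ - (∫ ω, (f ω).im ∂μ) * ∫ ω, (g ω).re ∂μ) := by
    rw [Complex.sub_im, Complex.mul_im, im_integral hfg, re_integral hfi, re_integral hgi,
      im_integral hfi, im_integral hgi]
    simp_rw [Complex.mul_im]
    rw [integral_add (irr hfr bfr hgim bgi) (irr hfim bfi hgr bgr)]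
    ring
  refine (ENNReal.ofReal_le_ofReal (Complex.norm_le_abs_re_add_abs_im _)).trans ?_
  rw [hre, him]
  refine (ENNReal.ofReal_le_ofReal (add_le_add (abs_sub _ _) (abs_add_le _ _))).trans ?_
  rw [ENNReal.ofReal_add (by positivity) (by positivity),
    ENNReal.ofReal_add (by positivity) (by positivity),
    ENNReal.ofReal_add (by positivity) (by positivity)]
  refine (add_le_add (add_le_add k1 k2) (add_le_add k3 k4)).trans_eq ?_
  ring

end Mixing

/-! ### Telescoping of products in the unit disc. -/

section Telescoping

/-- The factors are exchanged one at a time; each exchange is multiplied by factors of modulus at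
most one. -/
lemma norm_prod_sub_prod_le {ι : Type*} (s : Finset ι) {a b : ι → ℂ} (ha : ∀ i ∈ s, ‖a i‖ ≤ 1)
    (hb : ∀ i ∈ s, ‖b i‖ ≤ 1) :
    ‖∏ i ∈ s, a i - ∏ i ∈ s, b i‖ ≤ ∑ i ∈ s, ‖a i - b i‖ := by
  classical
  induction s using Finset.induction_on with
  | empty => simp
  | insert i s hi ih =>
    rw [Finset.prod_insert hi, Finset.prod_insert hi, Finset.sum_insert hi]
    have h1 : a i * ∏ j ∈ s, a j - b i * ∏ j ∈ s, b j
        = (a i - b i) * ∏ j ∈ s, a j + b i * (∏ j ∈ s, a j - ∏ j ∈ s, b j) := by ring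
    have h2 : ‖∏ j ∈ s, a j‖ ≤ 1 := by
      rw [norm_prod]
      exact Finset.prod_le_one (fun _ _ => norm_nonneg _)
        fun j hj => ha j (Finset.mem_insert_of_mem hj)
    have h3 := ih (fun j hj => ha j (Finset.mem_insert_of_mem hj))
      (fun j hj => hb j (Finset.mem_insert_of_mem hj))
    rw [h1]
    refine (norm_add_le _ _).trans (add_le_add ?_ ?_)
    · rw [norm_mul]; exact mul_le_of_le_one_right (norm_nonneg _) h2
    · rw [norm_mul]
      exact (mul_le_of_le_one_left (norm_nonneg _) (hb i (Finset.mem_insert_self _ _))).trans h3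

lemma norm_pow_sub_pow_le {a b : ℂ} (ha : ‖a‖ ≤ 1) (hb : ‖b‖ ≤ 1) (n : ℕ) :
    ‖a ^ n - b ^ n‖ ≤ n * ‖a - b‖ := by
  simpa using norm_prod_sub_prod_le (Finset.range n) (fun _ _ => ha) (fun _ _ => hb)

variable {Ω : Type*} {mΩ : MeasurableSpace Ω} {μ : Measure Ω} [IsProbabilityMeasure μ]

lemma norm_integral_le_one {f : Ω → ℂ} (hf : ∀ ω, ‖f ω‖ ≤ 1) : ‖∫ ω, f ω ∂μ‖ ≤ 1 := by
  simpa using norm_integral_le_of_norm_le_const (μ := μ) (ae_of_all _ hf)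

/-- If each factor is almost uncorrelated with the product of the preceding ones, the expectation
of the product is close to the product of the expectations. -/
lemma ofReal_norm_integral_prod_sub_prod_integral_le {F : ℕ → Ω → ℂ} (hF : ∀ i ω, ‖F i ω‖ ≤ 1)
    {b : ℝ≥0∞} {N : ℕ} (h : ∀ l < N, ENNReal.ofReal
      ‖∫ ω, (∏ i ∈ Finset.Icc 1 l, F i ω) * F (l + 1) ω ∂μ
        - (∫ ω, ∏ i ∈ Finset.Icc 1 l, F i ω ∂μ) * ∫ ω, F (l + 1) ω ∂μ‖ ≤ b) :
    ENNReal.ofReal ‖∫ ω, ∏ i ∈ Finset.Icc 1 N, F i ω ∂μ - ∏ i ∈ Finset.Icc 1 N, ∫ ω, F i ω ∂μ‖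
      ≤ N * b := by
  induction N with
  | zero => simp
  | succ N ih =>
    have h1 := ih fun l hl => h l (hl.trans N.lt_succ_self)
    have h2 := h N N.lt_succ_self
    simp_rw [Finset.prod_Icc_succ_top (Nat.le_add_left 1 N)]
    set x := ∫ ω, (∏ i ∈ Finset.Icc 1 N, F i ω) * F (N + 1) ω ∂μ
    set y := ∫ ω, ∏ i ∈ Finset.Icc 1 N, F i ω ∂μ
    set z := ∫ ω, F (N + 1) ω ∂μ
    set w := ∏ i ∈ Finset.Icc 1 N, ∫ ω, F i ω ∂μ
    -- The new error is the covariance of the last factor with the preceding product; the old error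
    -- is only multiplied by `z`, of modulus at most one.
    have h3 : ‖x - w * z‖ ≤ ‖x - y * z‖ + ‖y - w‖ := by
      have : x - w * z = (x - y * z) + (y - w) * z := by ring
      rw [this]
      refine (norm_add_le _ _).trans (add_le_add le_rfl ?_)
      rw [norm_mul]
      exact mul_le_of_le_one_right (norm_nonneg _) (norm_integral_le_one (hF _))
    refine (ENNReal.ofReal_le_ofReal h3).trans ?_
    rw [ENNReal.ofReal_add (norm_nonneg _) (norm_nonneg _)]
    refine (add_le_add h2 h1).trans_eq ?_
    push_cast
    ring

end Telescoping

/-! ### Monotonicity of the generated σ-fields. -/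

section SigmaField

variable {Ω S : Type*} {mΩ : MeasurableSpace Ω} [MeasurableSpace S] {ξ : ℕ → Ω → S}

lemma sigmaField_le {i j : ℕ} (h : ∀ l ∈ Set.Icc i j, Measurable (ξ l)) :
    sigmaField ξ i j ≤ mΩ :=
  iSup₂_le fun l hl => (h l hl).comap_le

lemma sigmaField_mono {i j i' j' : ℕ} (hi : i' ≤ i) (hj : j ≤ j') :
    sigmaField ξ i j ≤ sigmaField ξ i' j' :=
  biSup_mono fun _ hl => ⟨hi.trans hl.1, hl.2.trans hj⟩

lemma comap_le_sigmaField {i j l : ℕ} (hi : i ≤ l) (hj : l ≤ j) :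
    MeasurableSpace.comap (ξ l) inferInstance ≤ sigmaField ξ i j :=
  le_iSup₂_of_le l ⟨hi, hj⟩ le_rfl

end SigmaField

/-! ### Near-factorization of expectations under β-mixing. -/

section BlockMixing

variable {Ω S : Type*} [mΩ : MeasurableSpace Ω] {μ : Measure Ω} [IsProbabilityMeasure μ]
  [MeasurableSpace S] {ξ : ℕ → Ω → S}

lemma norm_prod_le_one {ι : Type*} (s : Finset ι) {a : ι → ℂ} (ha : ∀ i ∈ s, ‖a i‖ ≤ 1) :
    ‖∏ i ∈ s, a i‖ ≤ 1 := by
  rw [norm_prod]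
  exact Finset.prod_le_one (fun _ _ => norm_nonneg _) ha

/-- Expectation of products of functions of the successive members of a β-mixing sequence. -/
lemma ofReal_norm_integral_prod_sub_le_betaMixing {N : ℕ}
    (hξ : ∀ l ∈ Set.Icc 1 N, Measurable (ξ l)) {F : ℕ → Ω → ℂ} (hF1 : ∀ i ω, ‖F i ω‖ ≤ 1)
    (hF : ∀ i ∈ Set.Icc 1 N, Measurable[MeasurableSpace.comap (ξ i) inferInstance] (F i)) :
    ENNReal.ofReal ‖∫ ω, ∏ i ∈ Finset.Icc 1 N, F i ω ∂μ - ∏ i ∈ Finset.Icc 1 N, ∫ ω, F i ω ∂μ‖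
      ≤ N * (16 * betaMixing μ ξ N 0) := by
  refine ofReal_norm_integral_prod_sub_prod_integral_le hF1 fun l hl => ?_
  -- The mixing coefficient covers only `l ≥ 1`; for `l = 0` the preceding product is empty.
  rcases Nat.eq_zero_or_pos l with rfl | hl0
  · simp
  have hle : absReg μ (sigmaField ξ 1 l) (sigmaField ξ (l + 0 + 1) N) ≤ betaMixing μ ξ N 0 :=
    le_iSup₂_of_le l ⟨hl0, by omega⟩ le_rfl
  refine le_trans (norm_integral_mul_sub_le_absReg (𝓐 := sigmaField ξ 1 l)
    (𝓑 := sigmaField ξ (l + 0 + 1) N) ?_ ?_ ?_ ?_ ?_ (hF1 _)) (by gcongr)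
  · exact sigmaField_le fun i hi => hξ i ⟨hi.1, hi.2.trans hl.le⟩
  · exact sigmaField_le fun i hi => hξ i ⟨by have := hi.1; omega, hi.2⟩
  · refine Finset.measurable_fun_prod _ fun i hi => ?_
    rw [Finset.mem_Icc] at hi
    exact (hF i ⟨hi.1, hi.2.trans hl.le⟩).mono (comap_le_sigmaField hi.1 hi.2) le_rfl
  · exact fun ω => norm_prod_le_one _ fun i _ => hF1 i ω
  · exact (hF _ ⟨by omega, hl⟩).mono (comap_le_sigmaField (by omega) hl) le_rfl

/-- Expectation of products over a residue class modulo `k` of functions of overlapping blocks of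
a β-mixing sequence. -/
lemma ofReal_norm_integral_prod_residue_sub_le_betaMixing {N m r s k : ℕ} (hs : 1 ≤ s)
    (hr : 1 ≤ r) (hk : 2 ≤ k) (hsr : s ≤ (k - 1) * r) (hm : m * r + s - 1 ≤ N)
    (hξ : ∀ l ∈ Set.Icc 1 N, Measurable (ξ l)) {F : ℕ → Ω → ℂ} (hF1 : ∀ i ω, ‖F i ω‖ ≤ 1)
    (hF : ∀ i ∈ Set.Icc 1 m,
      Measurable[sigmaField ξ ((i - 1) * r + 1) (i * r + s - 1)] (F i)) (j : ℕ) :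
    ENNReal.ofReal ‖∫ ω, ∏ i ∈ Finset.Icc 1 m, (if i % k = j then F i ω else 1) ∂μ
        - ∏ i ∈ Finset.Icc 1 m, ∫ ω, (if i % k = j then F i ω else 1) ∂μ‖
      ≤ m * (16 * betaMixing μ ξ N ((k - 1) * r - s)) := by
  have hG1 : ∀ i ω, ‖if i % k = j then F i ω else 1‖ ≤ 1 := fun i ω => by
    split_ifs
    · exact hF1 i ω
    · simp
  refine ofReal_norm_integral_prod_sub_prod_integral_le hG1 fun l hl => ?_
  by_cases hj : (l + 1) % k = j
  swap
  · simp [hj]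
  -- Indices start at 1, so among the first `k` of them no residue repeats and `l + 1` has no
  -- predecessor in its class.
  by_cases hlk : l + 1 ≤ k
  · have : ∀ ω, ∏ i ∈ Finset.Icc 1 l, (if i % k = j then F i ω else 1) = 1 := fun ω => by
      refine Finset.prod_eq_one fun i hi => if_neg fun hij => ?_
      rw [Finset.mem_Icc] at hi
      rw [Nat.mod_eq_of_lt (by omega)] at hij
      rcases hlk.lt_or_eq with h | h
      · rw [Nat.mod_eq_of_lt h] at hj; omega
      · rw [h, Nat.mod_self] at hj; omega
    simp [this]
  push Not at hlk
  -- `q` is the last member of the residue class before `l + 1`.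
  obtain ⟨q, hq, hq1⟩ : ∃ q, l + 1 = q + k ∧ 1 ≤ q := ⟨l + 1 - k, by omega, by omega⟩
  obtain ⟨k', rfl⟩ : ∃ k', k = k' + 1 := ⟨k - 1, by omega⟩
  simp only [Nat.add_sub_cancel] at hsr ⊢
  have hlr : l * r = q * r + k' * r := by
    have : l = q + k' := by omega
    rw [this, add_mul]
  have hqr : r ≤ q * r := Nat.le_mul_of_pos_left r hq1
  have hlm : (l + 1) * r ≤ m * r := Nat.mul_le_mul_right r hl
  rw [add_mul, one_mul] at hlm
  -- Block `q` ends at time `q * r + s - 1` and block `l + 1` starts at `l * r + 1`. The σ-field of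
  -- the future in the coefficient starts one step earlier, at `l * r`, which only enlarges it.
  have hgap : q * r + s - 1 + (k' * r - s) + 1 = l * r := by omega
  have hle : absReg μ (sigmaField ξ 1 (q * r + s - 1))
      (sigmaField ξ (q * r + s - 1 + (k' * r - s) + 1) N) ≤ betaMixing μ ξ N (k' * r - s) :=
    le_iSup₂_of_le (q * r + s - 1) ⟨by omega, by omega⟩ le_rfl
  refine le_trans (norm_integral_mul_sub_le_absReg (𝓐 := sigmaField ξ 1 (q * r + s - 1))
    (𝓑 := sigmaField ξ (q * r + s - 1 + (k' * r - s) + 1) N) ?_ ?_ ?_ ?_ ?_ (hG1 _)) (by gcongr)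
  · exact sigmaField_le fun i hi => hξ i ⟨hi.1, hi.2.trans (by omega)⟩
  · exact sigmaField_le fun i hi => hξ i ⟨by have := hi.1; omega, hi.2⟩
  · refine Finset.measurable_fun_prod _ fun i hi => ?_
    rw [Finset.mem_Icc] at hi
    by_cases hij : i % (k' + 1) = j
    · have hiq : i ≤ q := by
        by_contra hlt
        push Not at hlt
        have h1 : (l + 1) % (k' + 1) = q % (k' + 1) := by rw [hq]; simp
        have h2 : i ≡ q [MOD k' + 1] := by
          show i % (k' + 1) = q % (k' + 1)
          omega
        have h3 : k' + 1 ∣ i - q := (Nat.modEq_iff_dvd' hlt.le).1 h2.symm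
        have := Nat.le_of_dvd (by omega) h3
        omega
      have hiqr : i * r ≤ q * r := Nat.mul_le_mul_right r hiq
      simp only [hij, if_true]
      exact (hF i ⟨hi.1, by omega⟩).mono (sigmaField_mono (by omega) (by omega)) le_rfl
    · simp only [hij, if_false]
      exact measurable_const
  · exact fun ω => norm_prod_le_one _ fun i _ => hG1 i ω
  · simp only [hj, if_true]
    have hl1 : (l + 1) * r = l * r + r := by ring
    refine (hF (l + 1) ⟨by omega, hl⟩).mono (sigmaField_mono ?_ (by omega)) le_rfl
    rw [Nat.add_sub_cancel]
    omega

end BlockMixing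

/-! ### Taylor bounds for the character exp(ix). -/

/-- The function `x ↦ exp (i x)` of a real variable. -/
noncomputable def expI (x : ℝ) : ℂ := Complex.exp (x * Complex.I)

section ExpI

@[simp] lemma norm_expI (x : ℝ) : ‖expI x‖ = 1 := Complex.norm_exp_ofReal_mul_I x


lemma expI_add (x y : ℝ) : expI (x + y) = expI x * expI y := by
  simp [expI, add_mul, Complex.exp_add]

lemma expI_sub (x y : ℝ) : expI (x - y) = expI x * expI (-y) := by
  rw [sub_eq_add_neg, expI_add]

lemma expI_sum {ι : Type*} (s : Finset ι) (f : ι → ℝ) :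
    expI (∑ i ∈ s, f i) = ∏ i ∈ s, expI (f i) := by
  simp [expI, Finset.sum_mul, Complex.exp_sum]

@[fun_prop] lemma continuous_expI : Continuous expI := by unfold expI; fun_prop

@[fun_prop] lemma measurable_expI : Measurable expI := continuous_expI.measurable

lemma norm_expI_sub_one_le (x : ℝ) : ‖expI x - 1‖ ≤ |x| := by
  rw [expI, mul_comm]; exact Real.norm_exp_I_mul_ofReal_sub_one_le

lemma norm_expI_sub_one_sub_le (x : ℝ) : ‖expI x - 1 - x * Complex.I‖ ≤ 3 * x ^ 2 := by
  have hx : ‖(x : ℂ) * Complex.I‖ = |x| := by simp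
  rcases le_or_gt |x| 1 with h | h
  · have := Complex.norm_exp_sub_one_sub_id_le (x := x * Complex.I) (by rwa [hx])
    rw [hx, sq_abs] at this
    exact this.trans (by nlinarith [sq_nonneg x])
  · calc ‖expI x - 1 - x * Complex.I‖ ≤ ‖expI x - 1‖ + ‖(x : ℂ) * Complex.I‖ := norm_sub_le _ _
      _ ≤ |x| + |x| := by rw [hx]; gcongr; exact norm_expI_sub_one_le x
      _ ≤ 3 * x ^ 2 := by rw [← sq_abs]; nlinarith

/-- One factor |x| of the cubic remainder is traded for ε. Where |x| > ε the cruder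
`norm_expI_taylor_two_le` is used, and the Lindeberg condition absorbs it. -/
lemma norm_expI_taylor_two_le_of_abs_le {x ε : ℝ} (h : |x| ≤ ε) (hε : ε ≤ 1) :
    ‖expI x - 1 - x * Complex.I + x ^ 2 / 2‖ ≤ ε * x ^ 2 := by
  have hx : ‖(x : ℂ) * Complex.I‖ = |x| := by simp
  have h3 := Complex.exp_bound (x := x * Complex.I) (by rw [hx]; exact h.trans hε)
    (n := 3) (by norm_num)
  rw [hx] at h3
  have e : Complex.exp (x * Complex.I) - ∑ m ∈ Finset.range 3, (x * Complex.I) ^ m / (m.factorial)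
      = expI x - 1 - x * Complex.I + x ^ 2 / 2 := by
    simp [Finset.sum_range_succ, expI, mul_pow]
    ring
  rw [e] at h3
  refine h3.trans ?_
  have hn : ((Nat.succ 3 : ℕ) : ℝ) * ((Nat.factorial 3 : ℕ) * (3 : ℕ) : ℝ)⁻¹ ≤ 1 := by
    norm_num [Nat.factorial]
  calc |x| ^ 3 * (((Nat.succ 3 : ℕ) : ℝ) * ((Nat.factorial 3 : ℕ) * (3 : ℕ) : ℝ)⁻¹)
      ≤ |x| ^ 3 := mul_le_of_le_one_right (by positivity) hn
    _ = |x| * x ^ 2 := by rw [← sq_abs]; ring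
    _ ≤ ε * x ^ 2 := by gcongr

lemma norm_expI_taylor_two_le (x : ℝ) :
    ‖expI x - 1 - x * Complex.I + x ^ 2 / 2‖ ≤ 4 * x ^ 2 := by
  calc ‖expI x - 1 - x * Complex.I + x ^ 2 / 2‖
      ≤ ‖expI x - 1 - x * Complex.I‖ + ‖(x : ℂ) ^ 2 / 2‖ := norm_add_le _ _
    _ ≤ 3 * x ^ 2 + x ^ 2 / 2 := by
        gcongr
        · exact norm_expI_sub_one_sub_le x
        · simp
    _ ≤ 4 * x ^ 2 := by nlinarith [sq_nonneg x]

end ExpI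

/-! ### Characteristic functions of a single block. -/

section CharacteristicFunctionBounds

variable {Ω : Type*} [MeasurableSpace Ω] {μ : Measure Ω} [IsProbabilityMeasure μ]

lemma integrable_expI {U : Ω → ℝ} (hU : AEMeasurable U μ) : Integrable (fun ω => expI (U ω)) μ :=
  .of_bound (measurable_expI.comp_aemeasurable hU).aestronglyMeasurable 1
    (ae_of_all _ fun _ => (norm_expI _).le)

/-- Changing a random variable on an event of small probability. -/
lemma norm_integral_expI_sub_le {X Y : Ω → ℝ} (hX : Measurable X) (hY : Measurable Y) :
    ‖∫ ω, expI (X ω) ∂μ - ∫ ω, expI (Y ω) ∂μ‖ ≤ 2 * μ.real {ω | X ω ≠ Y ω} := by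
  have hS : MeasurableSet {ω | X ω ≠ Y ω} := (measurableSet_eq_fun hX hY).compl
  rw [← integral_sub (integrable_expI hX.aemeasurable) (integrable_expI hY.aemeasurable)]
  have h1 : ∫ ω, ({ω | X ω ≠ Y ω}.indicator (fun _ => (2 : ℝ))) ω ∂μ
      = 2 * μ.real {ω | X ω ≠ Y ω} := by
    rw [integral_indicator hS]; simp [mul_comm]
  rw [← h1]
  refine norm_integral_le_of_norm_le ((integrable_const _).indicator hS) (ae_of_all _ fun ω => ?_)
  by_cases h : X ω = Y ω
  · simp [h]
  · rw [Set.indicator_of_mem (by exact h)]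
    exact (norm_sub_le _ _).trans (by simp; norm_num)

/-- The characteristic function of a centered, square integrable variable, up to an exceptional
event. -/
lemma norm_integral_expI_sub_one_le {R T : Ω → ℝ} (hR : Measurable R) (hT : Measurable T)
    (hT2 : MemLp T 2 μ) (hT0 : ∫ ω, T ω ∂μ = 0) :
    ‖∫ ω, expI (R ω) ∂μ - 1‖ ≤ 2 * μ.real {ω | R ω ≠ T ω} + 3 * ∫ ω, T ω ^ 2 ∂μ := by
  have hTi : Integrable T μ := hT2.integrable (by norm_num)
  have h1 : ∫ ω, expI (T ω) ∂μ - 1 = ∫ ω, (expI (T ω) - 1 - T ω * Complex.I) ∂μ := by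
    rw [integral_sub, integral_sub, integral_mul_const, integral_complex_ofReal, hT0]
    · simp
    · exact integrable_expI hT.aemeasurable
    · exact integrable_const _
    · exact (integrable_expI hT.aemeasurable).sub (integrable_const _)
    · exact hTi.ofReal.mul_const _
  calc ‖∫ ω, expI (R ω) ∂μ - 1‖
      = ‖(∫ ω, expI (R ω) ∂μ - ∫ ω, expI (T ω) ∂μ) + (∫ ω, expI (T ω) ∂μ - 1)‖ := by
        congr 1; ring
    _ ≤ 2 * μ.real {ω | R ω ≠ T ω} + 3 * ∫ ω, T ω ^ 2 ∂μ := by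
        refine (norm_add_le _ _).trans (add_le_add (norm_integral_expI_sub_le hR hT) ?_)
        rw [h1, ← integral_const_mul]
        exact norm_integral_le_of_norm_le (hT2.integrable_sq.const_mul 3)
          (ae_of_all _ fun ω => norm_expI_sub_one_sub_le _)

/-- Comparison of the characteristic functions of `U` and of `U - R`. -/
lemma norm_integral_expI_sub_sub_le {U R T : Ω → ℝ} (hU : Measurable U) (hR : Measurable R)
    (hT : Measurable T) (hU2 : MemLp U 2 μ) (hT2 : MemLp T 2 μ) (hT0 : ∫ ω, T ω ∂μ = 0) :
    ‖∫ ω, expI (U ω - R ω) ∂μ - ∫ ω, expI (U ω) ∂μ‖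
      ≤ 2 * μ.real {ω | R ω ≠ T ω} + 3 * ∫ ω, T ω ^ 2 ∂μ + ∫ ω, |U ω| * |T ω| ∂μ := by
  have hTi : Integrable T μ := hT2.integrable (by norm_num)
  have hUT : Integrable (fun ω => |U ω| * |T ω|) μ := hU2.abs.integrable_mul hT2.abs
  have hTI : Integrable (fun ω => (T ω : ℂ) * Complex.I) μ := hTi.ofReal.mul_const _
  -- Since `T` is centered, its linear term can be inserted at no cost. Without it the error would
  -- be of order E|T|, which E T² = o(1/m) does not make o(1/m).
  have h1 : ∫ ω, expI (U ω - T ω) ∂μ - ∫ ω, expI (U ω) ∂μ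
      = ∫ ω, (expI (U ω - T ω) - expI (U ω) + T ω * Complex.I) ∂μ := by
    rw [integral_add, integral_sub, integral_mul_const, integral_complex_ofReal, hT0]
    · simp
    · exact integrable_expI (hU.sub hT).aemeasurable
    · exact integrable_expI hU.aemeasurable
    · exact (integrable_expI (hU.sub hT).aemeasurable).sub (integrable_expI hU.aemeasurable)
    · exact hTI
  have hset : {ω | U ω - R ω ≠ U ω - T ω} = {ω | R ω ≠ T ω} := by ext ω; simp
  calc ‖∫ ω, expI (U ω - R ω) ∂μ - ∫ ω, expI (U ω) ∂μ‖
      = ‖(∫ ω, expI (U ω - R ω) ∂μ - ∫ ω, expI (U ω - T ω) ∂μ)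
          + (∫ ω, expI (U ω - T ω) ∂μ - ∫ ω, expI (U ω) ∂μ)‖ := by congr 1; ring
    _ ≤ 2 * μ.real {ω | R ω ≠ T ω} + (3 * ∫ ω, T ω ^ 2 ∂μ + ∫ ω, |U ω| * |T ω| ∂μ) := by
        refine (norm_add_le _ _).trans (add_le_add ?_ ?_)
        · rw [← hset]; exact norm_integral_expI_sub_le (hU.sub hR) (hU.sub hT)
        rw [h1, ← integral_const_mul, ← integral_add (hT2.integrable_sq.const_mul 3) hUT]
        refine norm_integral_le_of_norm_le ((hT2.integrable_sq.const_mul 3).add hUT)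
          (ae_of_all _ fun ω => ?_)
        have e : expI (U ω - T ω) - expI (U ω) + T ω * Complex.I
            = expI (U ω) * (expI (-T ω) - 1 - ((-T ω : ℝ) : ℂ) * Complex.I)
              + (expI (U ω) - 1) * (-(T ω * Complex.I)) := by
          rw [expI_sub]; push_cast; ring
        rw [e]
        refine (norm_add_le _ _).trans (add_le_add ?_ ?_)
        · rw [norm_mul, norm_expI, one_mul]
          simpa using norm_expI_sub_one_sub_le (-T ω)
        · rw [norm_mul]
          have : ‖-((T ω : ℂ) * Complex.I)‖ = |T ω| := by simp
          rw [this]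
          gcongr
          exact norm_expI_sub_one_le _
    _ = _ := by ring

/-- Second order expansion of a characteristic function with a Lindeberg remainder. -/
lemma norm_integral_expI_taylor_le {U : Ω → ℝ} (hU : Measurable U) (hU2 : MemLp U 2 μ)
    (hU0 : ∫ ω, U ω ∂μ = 0) {ε : ℝ} (hε0 : 0 ≤ ε) (hε : ε ≤ 1) :
    ‖∫ ω, expI (U ω) ∂μ - (1 - (∫ ω, U ω ^ 2 ∂μ) / 2 : ℝ)‖
      ≤ ε * ∫ ω, U ω ^ 2 ∂μ + 4 * ∫ ω in {ω | ε < |U ω|}, U ω ^ 2 ∂μ := by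
  have hUi : Integrable U μ := hU2.integrable (by norm_num)
  have hUsq := hU2.integrable_sq
  have hUI : Integrable (fun ω => (U ω : ℂ) * Complex.I) μ := hUi.ofReal.mul_const _
  have hU2c : Integrable (fun ω => (U ω : ℂ) ^ 2 / 2) μ := by
    simpa using (hUsq.ofReal (𝕜 := ℂ)).div_const 2
  have hE := integrable_expI (μ := μ) hU.aemeasurable
  have hS : MeasurableSet {ω | ε < |U ω|} := measurableSet_lt measurable_const hU.abs
  have e1 : ∫ ω, expI (U ω) ∂μ - (1 - (∫ ω, U ω ^ 2 ∂μ) / 2 : ℝ)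
      = ∫ ω, (expI (U ω) - 1 - U ω * Complex.I + U ω ^ 2 / 2) ∂μ := by
    have hsq : ∫ ω, (U ω : ℂ) ^ 2 / 2 ∂μ = (((∫ ω, U ω ^ 2 ∂μ) / 2 : ℝ) : ℂ) := by
      rw [integral_div]
      push_cast
      rw [← integral_complex_ofReal]
      push_cast
      rfl
    have i1 : Integrable (fun ω => expI (U ω) - 1) μ := hE.sub (integrable_const _)
    have i2 : Integrable (fun ω => expI (U ω) - 1 - U ω * Complex.I) μ := i1.sub hUI
    rw [integral_add i2 hU2c, integral_sub i1 hUI, integral_sub hE (integrable_const _),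
      integral_mul_const, integral_complex_ofReal, hU0, hsq]
    simp
    ring
  rw [e1, ← integral_const_mul, ← integral_const_mul, ← integral_indicator hS,
    ← integral_add (hUsq.const_mul ε) ((hUsq.const_mul 4).indicator hS)]
  refine norm_integral_le_of_norm_le ((hUsq.const_mul ε).add ((hUsq.const_mul 4).indicator hS))
    (ae_of_all _ fun ω => ?_)
  by_cases h : ε < |U ω|
  · rw [Set.indicator_of_mem (by exact h)]
    exact (norm_expI_taylor_two_le _).trans (le_add_of_nonneg_left (by positivity))
  · rw [Set.indicator_of_notMem (by exact h), add_zero]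
    exact norm_expI_taylor_two_le_of_abs_le (not_lt.1 h) hε

end CharacteristicFunctionBounds

/-! ### Limits of powers of characteristic functions. -/

section Limits

/-- A squeeze argument in which the bound is small only after the choice of a parameter. -/
lemma tendsto_zero_of_forall_le {f g : ℕ → ℝ} {h : ℝ → ℕ → ℝ} {C : ℝ} (hf : ∀ n, 0 ≤ f n)
    (hg : Tendsto g atTop (𝓝 C)) (hh : ∀ ε, 0 < ε → ε ≤ 1 → Tendsto (h ε) atTop (𝓝 0))
    (hle : ∀ ε, 0 < ε → ε ≤ 1 → ∀ᶠ n in atTop, f n ≤ ε * g n + h ε n) :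
    Tendsto f atTop (𝓝 0) := by
  refine Metric.tendsto_atTop'.2 fun δ hδ => ?_
  -- Chosen so that ε times the eventual bound |C| + 1 of `g` takes at most half of δ.
  set ε := min 1 (δ / (2 * (|C| + 1))) with hε
  have hC : 0 < |C| + 1 := by positivity
  have hε0 : 0 < ε := lt_min one_pos (by positivity)
  have hε1 : ε ≤ 1 := min_le_left _ _
  have hεC : ε * (|C| + 1) ≤ δ / 2 := by
    calc ε * (|C| + 1) ≤ δ / (2 * (|C| + 1)) * (|C| + 1) := by gcongr; exact min_le_right _ _
      _ = δ / 2 := by field_simp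
  have h1 : ∀ᶠ n in atTop, g n < |C| + 1 :=
    hg.eventually_lt_const ((le_abs_self C).trans_lt (lt_add_one _))
  have h2 : ∀ᶠ n in atTop, h ε n < δ / 2 := (hh ε hε0 hε1).eventually_lt_const (half_pos hδ)
  obtain ⟨N, hN⟩ := eventually_atTop.1 ((h1.and h2).and (hle ε hε0 hε1))
  refine ⟨N, fun n hn => ?_⟩
  obtain ⟨⟨h1, h2⟩, h3⟩ := hN n hn.le
  rw [Real.dist_eq, sub_zero, abs_of_nonneg (hf n)]
  have : ε * g n ≤ ε * (|C| + 1) := by gcongr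
  linarith

/-- The error of the linear approximation is at most (x/M)², hence o(1/M). -/
lemma tendsto_mul_norm_exp_neg_div_sub {M : ℕ → ℕ} (hM : Tendsto M atTop atTop) (x : ℝ) :
    Tendsto (fun n => (M n : ℝ) * ‖Complex.exp ((-x / M n : ℝ) : ℂ) - (1 - x / M n : ℝ)‖)
      atTop (𝓝 0) := by
  have hMr : Tendsto (fun n => (M n : ℝ)) atTop atTop := tendsto_natCast_atTop_atTop.comp hM
  have h0 : Tendsto (fun n => x ^ 2 / (M n : ℝ)) atTop (𝓝 0) := hMr.const_div_atTop _
  refine squeeze_zero' (Eventually.of_forall fun n => by positivity) ?_ h0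
  filter_upwards [hMr.eventually_ge_atTop (|x| + 1)] with n hn
  have hMpos : 0 < (M n : ℝ) := lt_of_lt_of_le (by positivity) hn
  have hy : |-x / (M n : ℝ)| ≤ 1 := by
    rw [abs_div, abs_neg, abs_of_pos hMpos, div_le_one hMpos]; linarith
  have h1 : ‖Complex.exp ((-x / M n : ℝ) : ℂ) - (1 - x / M n : ℝ)‖ ≤ (-x / M n) ^ 2 := by
    have e : Complex.exp ((-x / M n : ℝ) : ℂ) - (1 - x / M n : ℝ)
        = ((Real.exp (-x / M n) - 1 - (-x / M n) : ℝ) : ℂ) := by push_cast; ring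
    rw [e, Complex.norm_real]
    exact Real.abs_exp_sub_one_sub_id_le hy
  calc (M n : ℝ) * ‖Complex.exp ((-x / M n : ℝ) : ℂ) - (1 - x / M n : ℝ)‖
      ≤ M n * (-x / M n) ^ 2 := by gcongr
    _ = x ^ 2 / M n := by field_simp

/-- Writing exp(-x) as the M-th power of exp(-x/M), the distance between the powers is at most M
times the distance between the bases, so an error o(1/M) in the base is harmless. -/
lemma tendsto_pow_exp_neg {M : ℕ → ℕ} (hM : Tendsto M atTop atTop) {ψ : ℕ → ℂ}
    (hψ : ∀ n, ‖ψ n‖ ≤ 1) {x : ℝ} (hx : 0 ≤ x) {y : ℕ → ℝ}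
    (hy : Tendsto (fun n => (M n : ℝ) * y n) atTop (𝓝 x))
    (h : Tendsto (fun n => (M n : ℝ) * ‖ψ n - (1 - y n : ℝ)‖) atTop (𝓝 0)) :
    Tendsto (fun n => ψ n ^ M n) atTop (𝓝 (Complex.exp ((-x : ℝ) : ℂ))) := by
  rw [tendsto_iff_norm_sub_tendsto_zero]
  have h3 : Tendsto (fun n => (M n : ℝ) * ‖ψ n - (1 - y n : ℝ)‖ + |M n * y n - x|
      + (M n : ℝ) * ‖Complex.exp ((-x / M n : ℝ) : ℂ) - (1 - x / M n : ℝ)‖) atTop (𝓝 0) := by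
    simpa using (h.add ((hy.sub_const x).abs)).add (tendsto_mul_norm_exp_neg_div_sub hM x)
  refine squeeze_zero' (Eventually.of_forall fun n => norm_nonneg _) ?_ h3
  filter_upwards [hM.eventually_ge_atTop 1] with n hn
  have hMpos : 0 < (M n : ℝ) := by exact_mod_cast hn
  have e : Complex.exp ((-x : ℝ) : ℂ) = Complex.exp ((-x / M n : ℝ) : ℂ) ^ M n := by
    have hM0 : (M n : ℂ) ≠ 0 := by exact_mod_cast hMpos.ne'
    rw [← Complex.exp_nat_mul]
    congr 1
    push_cast
    field_simp
  have hexp : ‖Complex.exp ((-x / M n : ℝ) : ℂ)‖ ≤ 1 := by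
    rw [← Complex.ofReal_exp, Complex.norm_real, Real.norm_eq_abs, Real.abs_exp,
      Real.exp_le_one_iff]
    exact div_nonpos_of_nonpos_of_nonneg (by linarith) hMpos.le
  rw [e]
  refine (norm_pow_sub_pow_le (hψ n) hexp _).trans ?_
  have e2 : ψ n - Complex.exp ((-x / M n : ℝ) : ℂ) = (ψ n - (1 - y n : ℝ))
      + ((x / M n - y n : ℝ) : ℂ) - (Complex.exp ((-x / M n : ℝ) : ℂ) - (1 - x / M n : ℝ)) := by
    push_cast; ring
  have e3 : (M n : ℝ) * ‖((x / M n - y n : ℝ) : ℂ)‖ = |M n * y n - x| := by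
    rw [Complex.norm_real, Real.norm_eq_abs, ← abs_of_pos hMpos, ← abs_mul, abs_of_pos hMpos,
      abs_sub_comm]
    congr 1
    field_simp
  rw [← e3, ← mul_add, ← mul_add, e2]
  gcongr
  exact (norm_sub_le _ _).trans (by gcongr; exact norm_add_le _ _)

end Limits

/-! ### The central limit theorem for block arrays. -/

section BlockCLT

variable {Ω : Type*} [MeasurableSpace Ω] {μ : Measure Ω} [IsProbabilityMeasure μ]
  {M : ℕ → ℕ} {X Y T : ℕ → Ω → ℝ} {v : ℝ}

/-- Lindeberg's theorem for powers of characteristic functions. -/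
lemma tendsto_integral_expI_pow (hM : Tendsto M atTop atTop)
    (hX : ∀ᶠ n in atTop, Measurable (X n)) (hX2 : ∀ᶠ n in atTop, MemLp (X n) 2 μ)
    (hX0 : ∀ᶠ n in atTop, ∫ ω, X n ω ∂μ = 0)
    (hvar : Tendsto (fun n => M n * ∫ ω, X n ω ^ 2 ∂μ) atTop (𝓝 v))
    (hlind : ∀ ε, 0 < ε →
      Tendsto (fun n => M n * ∫ ω in {ω | ε < |X n ω|}, X n ω ^ 2 ∂μ) atTop (𝓝 0)) :
    Tendsto (fun n => (∫ ω, expI (X n ω) ∂μ) ^ M n) atTop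
      (𝓝 (Complex.exp ((-(v / 2) : ℝ) : ℂ))) := by
  have hv : 0 ≤ v := ge_of_tendsto' hvar fun n =>
    mul_nonneg (Nat.cast_nonneg _) (integral_nonneg fun ω => sq_nonneg _)
  refine tendsto_pow_exp_neg hM (fun n => norm_integral_le_one fun ω => (norm_expI _).le)
    (div_nonneg hv zero_le_two) (y := fun n => (∫ ω, X n ω ^ 2 ∂μ) / 2) ?_ ?_
  · simpa [mul_div_assoc] using hvar.div_const 2
  refine tendsto_zero_of_forall_le (g := fun n => M n * ∫ ω, X n ω ^ 2 ∂μ)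
    (h := fun ε n => 4 * (M n * ∫ ω in {ω | ε < |X n ω|}, X n ω ^ 2 ∂μ))
    (fun n => by positivity) hvar (fun ε hε _ => by simpa using (hlind ε hε).const_mul 4)
    fun ε hε hε1 => ?_
  filter_upwards [hX, hX2, hX0] with n h1 h2 h3
  have := mul_le_mul_of_nonneg_left (norm_integral_expI_taylor_le h1 h2 h3 hε.le hε1)
    (Nat.cast_nonneg (α := ℝ) (M n))
  linarith

/-- A negligible perturbation does not change the characteristic function to order `1 / M`. -/
lemma tendsto_mul_norm_integral_expI_sub_sub (hX : ∀ᶠ n in atTop, Measurable (X n))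
    (hY : ∀ᶠ n in atTop, Measurable (Y n)) (hT : ∀ᶠ n in atTop, Measurable (T n))
    (hX2 : ∀ᶠ n in atTop, MemLp (X n) 2 μ)
    (hvar : Tendsto (fun n => M n * ∫ ω, X n ω ^ 2 ∂μ) atTop (𝓝 v))
    (hT2 : ∀ᶠ n in atTop, MemLp (T n) 2 μ) (hT0 : ∀ᶠ n in atTop, ∫ ω, T n ω ∂μ = 0)
    (hTvar : Tendsto (fun n => M n * ∫ ω, T n ω ^ 2 ∂μ) atTop (𝓝 0))
    (htail : Tendsto (fun n => M n * μ.real {ω | Y n ω ≠ T n ω}) atTop (𝓝 0)) :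
    Tendsto (fun n => M n * ‖∫ ω, expI (X n ω - Y n ω) ∂μ - ∫ ω, expI (X n ω) ∂μ‖) atTop
      (𝓝 0) := by
  refine tendsto_zero_of_forall_le (g := fun n => M n * ∫ ω, X n ω ^ 2 ∂μ)
    (h := fun ε n => 2 * (M n * μ.real {ω | Y n ω ≠ T n ω})
      + (3 + ε⁻¹) * (M n * ∫ ω, T n ω ^ 2 ∂μ))
    (fun n => by positivity) hvar
    (fun ε hε _ => by simpa using (htail.const_mul 2).add (hTvar.const_mul (3 + ε⁻¹)))
    fun ε hε hε1 => ?_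
  filter_upwards [hX, hY, hT, hX2, hT2, hT0] with n h1 h2 h3 h4 h5 h6
  -- Young's inequality with weight ε: the `X` part stays bounded after multiplication by `M n` and
  -- is damped by ε, while the `T` part vanishes for each fixed ε.
  have hXT : ∫ ω, |X n ω| * |T n ω| ∂μ ≤ ε * ∫ ω, X n ω ^ 2 ∂μ + ε⁻¹ * ∫ ω, T n ω ^ 2 ∂μ := by
    rw [← integral_const_mul, ← integral_const_mul,
      ← integral_add (h4.integrable_sq.const_mul ε) (h5.integrable_sq.const_mul ε⁻¹)]
    refine integral_mono (h4.abs.integrable_mul h5.abs)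
      ((h4.integrable_sq.const_mul ε).add (h5.integrable_sq.const_mul ε⁻¹)) fun ω => ?_
    simp only [← sq_abs (X n ω), ← sq_abs (T n ω)]
    have h7 : 0 ≤ ε * (|X n ω| - ε⁻¹ * |T n ω|) ^ 2 := by positivity
    have h8 : ε * (|X n ω| - ε⁻¹ * |T n ω|) ^ 2
        = ε * |X n ω| ^ 2 + ε⁻¹ * |T n ω| ^ 2 - 2 * (|X n ω| * |T n ω|) := by
      field_simp
      ring
    have h9 : 0 ≤ |X n ω| * |T n ω| := by positivity
    linarith
  have := mul_le_mul_of_nonneg_left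
    ((norm_integral_expI_sub_sub_le h1 h2 h3 h4 h5 h6).trans (add_le_add_right hXT _))
    (Nat.cast_nonneg (α := ℝ) (M n))
  linarith

lemma tendsto_mul_norm_integral_expI_sub_one (hY : ∀ᶠ n in atTop, Measurable (Y n))
    (hT : ∀ᶠ n in atTop, Measurable (T n))
    (hT2 : ∀ᶠ n in atTop, MemLp (T n) 2 μ) (hT0 : ∀ᶠ n in atTop, ∫ ω, T n ω ∂μ = 0)
    (hTvar : Tendsto (fun n => M n * ∫ ω, T n ω ^ 2 ∂μ) atTop (𝓝 0))
    (htail : Tendsto (fun n => M n * μ.real {ω | Y n ω ≠ T n ω}) atTop (𝓝 0)) :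
    Tendsto (fun n => M n * ‖∫ ω, expI (Y n ω) ∂μ - 1‖) atTop (𝓝 0) := by
  have h : Tendsto (fun n => 2 * (M n * μ.real {ω | Y n ω ≠ T n ω})
      + 3 * (M n * ∫ ω, T n ω ^ 2 ∂μ)) atTop (𝓝 0) := by
    simpa using (htail.const_mul 2).add (hTvar.const_mul 3)
  refine squeeze_zero' (Eventually.of_forall fun n => by positivity) ?_ h
  filter_upwards [hY, hT, hT2, hT0] with n h1 h2 h3 h4
  have := mul_le_mul_of_nonneg_left (norm_integral_expI_sub_one_le h1 h2 h3 h4)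
    (Nat.cast_nonneg (α := ℝ) (M n))
  linarith

/-- Unimodular random variables whose means tend to `1` tend to `1` in mean. -/
lemma tendsto_integral_norm_sub_one {G : ℕ → Ω → ℂ} (hG : ∀ᶠ n in atTop, Measurable (G n))
    (hG1 : ∀ n ω, ‖G n ω‖ = 1) (h : Tendsto (fun n => ∫ ω, G n ω ∂μ) atTop (𝓝 1)) :
    Tendsto (fun n => ∫ ω, ‖G n ω - 1‖ ∂μ) atTop (𝓝 0) := by
  have h1 : Tendsto (fun n => 2 - 2 * (∫ ω, G n ω ∂μ).re) atTop (𝓝 0) := by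
    have := (((Complex.continuous_re.tendsto _).comp h).const_mul 2).const_sub 2
    simpa using this
  refine tendsto_zero_of_forall_le (g := fun _ => 1) (C := 1)
    (h := fun ε n => ε⁻¹ * (2 - 2 * (∫ ω, G n ω ∂μ).re)) (fun n => by positivity)
    tendsto_const_nhds (fun ε _ _ => by simpa using h1.const_mul ε⁻¹) fun ε hε _ => ?_
  filter_upwards [hG] with n hn
  have hGi : Integrable (G n) μ := .of_bound hn.aestronglyMeasurable 1
    (ae_of_all _ fun ω => (hG1 n ω).le)
  have hre0 : Integrable (fun ω => 2 * (G n ω).re) μ := hGi.re.const_mul 2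
  have hre : Integrable (fun ω => 2 - 2 * (G n ω).re) μ := (integrable_const _).sub hre0
  -- On the unit circle the squared distance to 1 is affine in the real part, so the mean alone
  -- controls the distance in L².
  have hsq : ∀ ω, ‖G n ω - 1‖ ^ 2 = 2 - 2 * (G n ω).re := fun ω => by
    have h1 : (G n ω).re ^ 2 + (G n ω).im ^ 2 = 1 := by
      have := Complex.sq_norm (G n ω)
      rw [hG1, Complex.normSq_apply] at this
      linarith
    rw [Complex.sq_norm, Complex.normSq_apply]
    simp
    linarith
  have e : ε * 1 + ε⁻¹ * (2 - 2 * (∫ ω, G n ω ∂μ).re)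
      = ∫ ω, (ε + ε⁻¹ * (2 - 2 * (G n ω).re)) ∂μ := by
    rw [integral_add (integrable_const _) (hre.const_mul _), integral_const_mul,
      integral_sub (integrable_const _) hre0, integral_const_mul,
      re_integral hGi]
    simp
  rw [e]
  refine integral_mono (hGi.sub (integrable_const _)).norm
    ((integrable_const _).add (hre.const_mul _)) fun ω => ?_
  simp only [← hsq]
  have h7 : 0 ≤ ε * (1 - ε⁻¹ * ‖G n ω - 1‖) ^ 2 := by positivity
  have h8 : ε * (1 - ε⁻¹ * ‖G n ω - 1‖) ^ 2
      = ε + ε⁻¹ * ‖G n ω - 1‖ ^ 2 - 2 * ‖G n ω - 1‖ := by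
    field_simp
    ring
  have h9 : 0 ≤ ‖G n ω - 1‖ := norm_nonneg _
  linarith

/-- Splitting a product over `1, …, m` into residue classes modulo `k`. -/
lemma prod_expI_eq_prod_residue {k m : ℕ} (hk : 0 < k) (f : ℕ → ℝ) :
    expI (∑ i ∈ Finset.Icc 1 m, f i)
      = ∏ j ∈ Finset.range k, ∏ i ∈ Finset.Icc 1 m, if i % k = j then expI (f i) else 1 := by
  rw [Finset.prod_comm, expI_sum]
  refine Finset.prod_congr rfl fun i _ => ?_
  rw [Finset.prod_ite_eq, if_pos (Finset.mem_range.2 (Nat.mod_lt _ hk))]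

variable {U R : ℕ → ℕ → Ω → ℝ} {k : ℕ}

/-- The sum of the negligible perturbations is negligible, if the products of their characters
over residue classes nearly factorize in mean. -/
lemma tendsto_integral_norm_expI_sum_sub_one (hk : 0 < k)
    (hR : ∀ᶠ n in atTop, ∀ i ∈ Finset.Icc 1 (M n), Measurable (R n i))
    (hid : ∀ᶠ n in atTop, ∀ i ∈ Finset.Icc 1 (M n), IdentDistrib (R n i) (R n 1) μ μ)
    (h1 : Tendsto (fun n => M n * ‖∫ ω, expI (R n 1 ω) ∂μ - 1‖) atTop (𝓝 0))
    (hmix : ∀ j, Tendsto (fun n =>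
      ‖∫ ω, ∏ i ∈ Finset.Icc 1 (M n), (if i % k = j then expI (R n i ω) else 1) ∂μ
        - ∏ i ∈ Finset.Icc 1 (M n), ∫ ω, (if i % k = j then expI (R n i ω) else 1) ∂μ‖)
      atTop (𝓝 0)) :
    Tendsto (fun n => ∫ ω, ‖expI (∑ i ∈ Finset.Icc 1 (M n), R n i ω) - 1‖ ∂μ) atTop (𝓝 0) := by
  set G : ℕ → ℕ → Ω → ℂ := fun j n ω =>
    ∏ i ∈ Finset.Icc 1 (M n), if i % k = j then expI (R n i ω) else 1 with hGdef
  have hG1 : ∀ j n ω, ‖G j n ω‖ = 1 := fun j n ω => by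
    rw [hGdef, norm_prod]
    refine Finset.prod_eq_one fun i _ => ?_
    split_ifs <;> simp
  have hGm : ∀ j, ∀ᶠ n in atTop, Measurable (G j n) := fun j => by
    filter_upwards [hR] with n hn
    refine Finset.measurable_fun_prod _ fun i hi => ?_
    by_cases hij : i % k = j
    · simp only [hij, if_true]; exact measurable_expI.comp (hn i hi)
    · simp only [hij, if_false]; exact measurable_const
  have hprod : ∀ j, Tendsto (fun n => ∏ i ∈ Finset.Icc 1 (M n),
      ∫ ω, (if i % k = j then expI (R n i ω) else 1) ∂μ) atTop (𝓝 1) := fun j => by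
    rw [tendsto_iff_norm_sub_tendsto_zero]
    refine squeeze_zero' (Eventually.of_forall fun n => norm_nonneg _) ?_ h1
    filter_upwards [hid] with n hn
    have h2 := norm_prod_sub_prod_le (Finset.Icc 1 (M n))
      (a := fun i => ∫ ω, (if i % k = j then expI (R n i ω) else 1) ∂μ) (b := fun _ => 1)
      (fun i _ => norm_integral_le_one fun ω => by split_ifs <;> simp) (fun _ _ => by simp)
    rw [Finset.prod_const_one] at h2
    refine h2.trans ?_
    have h3 : ∀ i ∈ Finset.Icc 1 (M n),
        ‖∫ ω, (if i % k = j then expI (R n i ω) else 1) ∂μ - 1‖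
          ≤ ‖∫ ω, expI (R n 1 ω) ∂μ - 1‖ := fun i hi => by
      by_cases hij : i % k = j
      · simp only [hij, if_true]
        have := ((hn i hi).comp measurable_expI).integral_eq
        simp only [Function.comp_apply] at this
        rw [this]
      · simp [hij]
    refine (Finset.sum_le_sum h3).trans ?_
    simp
  have hmean : ∀ j, Tendsto (fun n => ∫ ω, ‖G j n ω - 1‖ ∂μ) atTop (𝓝 0) := fun j => by
    refine tendsto_integral_norm_sub_one (hGm j) (hG1 j) ?_
    have := (tendsto_zero_iff_norm_tendsto_zero.2 (hmix j)).add (hprod j)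
    simpa using this
  have hsum : Tendsto (fun n => ∑ j ∈ Finset.range k, ∫ ω, ‖G j n ω - 1‖ ∂μ) atTop (𝓝 0) := by
    simpa using tendsto_finsetSum (Finset.range k) fun j _ => hmean j
  refine squeeze_zero' (Eventually.of_forall fun n => integral_nonneg fun ω => norm_nonneg _) ?_
    hsum
  have hGm' : ∀ᶠ n in atTop, ∀ j ∈ Finset.range k, Measurable (G j n) :=
    (Finset.eventually_all _).2 fun j _ => hGm j
  filter_upwards [hGm', hR] with n hn hRn
  have hi : ∀ j ∈ Finset.range k, Integrable (fun ω => ‖G j n ω - 1‖) μ := fun j hj => by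
    have : Integrable (G j n) μ := .of_bound (hn j hj).aestronglyMeasurable 1
      (ae_of_all _ fun ω => (hG1 j n ω).le)
    exact (this.sub (integrable_const _)).norm
  rw [← integral_finsetSum _ hi]
  refine integral_mono_of_nonneg (ae_of_all _ fun ω => norm_nonneg _)
    (integrable_finsetSum _ hi) (ae_of_all _ fun ω => ?_)
  -- The class products are mutually dependent, but pointwise the distance of their product from 1
  -- is at most the sum of their distances.
  have h2 := norm_prod_sub_prod_le (Finset.range k) (a := fun j => G j n ω) (b := fun _ => 1)
    (fun j _ => (hG1 j n ω).le) (fun _ _ => by simp)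
  rw [Finset.prod_const_one] at h2
  simpa only [prod_expI_eq_prod_residue hk] using h2

/-- **Central limit theorem for block arrays**, in terms of characteristic functions: the blocks
`U n i` are asymptotically independent up to negligible perturbations `R n i`. -/
theorem tendsto_integral_expI_sum (hk : 0 < k) (hM : Tendsto M atTop atTop)
    (hU : ∀ᶠ n in atTop, ∀ i ∈ Finset.Icc 1 (M n), Measurable (U n i))
    (hR : ∀ᶠ n in atTop, ∀ i ∈ Finset.Icc 1 (M n), Measurable (R n i))
    (hid : ∀ᶠ n in atTop, ∀ i ∈ Finset.Icc 1 (M n),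
      IdentDistrib (fun ω => (U n i ω, R n i ω)) (fun ω => (U n 1 ω, R n 1 ω)) μ μ)
    (hU2 : ∀ᶠ n in atTop, MemLp (U n 1) 2 μ)
    (hU0 : ∀ᶠ n in atTop, ∫ ω, U n 1 ω ∂μ = 0)
    (hvar : Tendsto (fun n => M n * ∫ ω, U n 1 ω ^ 2 ∂μ) atTop (𝓝 v))
    (hlind : ∀ ε, 0 < ε →
      Tendsto (fun n => M n * ∫ ω in {ω | ε < |U n 1 ω|}, U n 1 ω ^ 2 ∂μ) atTop (𝓝 0))
    (hT : ∀ᶠ n in atTop, Measurable (T n))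
    (hT2 : ∀ᶠ n in atTop, MemLp (T n) 2 μ) (hT0 : ∀ᶠ n in atTop, ∫ ω, T n ω ∂μ = 0)
    (hTvar : Tendsto (fun n => M n * ∫ ω, T n ω ^ 2 ∂μ) atTop (𝓝 0))
    (htail : Tendsto (fun n => M n * μ.real {ω | R n 1 ω ≠ T n ω}) atTop (𝓝 0))
    (hmixU : Tendsto (fun n =>
      ‖∫ ω, ∏ i ∈ Finset.Icc 1 (M n), expI (U n i ω - R n i ω) ∂μ
        - ∏ i ∈ Finset.Icc 1 (M n), ∫ ω, expI (U n i ω - R n i ω) ∂μ‖) atTop (𝓝 0))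
    (hmixR : ∀ j, Tendsto (fun n =>
      ‖∫ ω, ∏ i ∈ Finset.Icc 1 (M n), (if i % k = j then expI (R n i ω) else 1) ∂μ
        - ∏ i ∈ Finset.Icc 1 (M n), ∫ ω, (if i % k = j then expI (R n i ω) else 1) ∂μ‖)
      atTop (𝓝 0)) :
    Tendsto (fun n => ∫ ω, expI (∑ i ∈ Finset.Icc 1 (M n), U n i ω) ∂μ) atTop
      (𝓝 (Complex.exp ((-(v / 2) : ℝ) : ℂ))) := by
  have hM1 : ∀ᶠ n in atTop, 1 ∈ Finset.Icc 1 (M n) := by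
    filter_upwards [hM.eventually_ge_atTop 1] with n hn
    exact Finset.mem_Icc.2 ⟨le_rfl, hn⟩
  have hU1 : ∀ᶠ n in atTop, Measurable (U n 1) := by
    filter_upwards [hM1, hU] with n h1 h2 using h2 1 h1
  have hR1 : ∀ᶠ n in atTop, Measurable (R n 1) := by
    filter_upwards [hM1, hR] with n h1 h2 using h2 1 h1
  have hpow := tendsto_integral_expI_pow hM hU1 hU2 hU0 hvar hlind
  have hpow' : Tendsto (fun n => (∫ ω, expI (U n 1 ω - R n 1 ω) ∂μ) ^ M n
      - (∫ ω, expI (U n 1 ω) ∂μ) ^ M n) atTop (𝓝 0) := by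
    rw [tendsto_zero_iff_norm_tendsto_zero]
    refine squeeze_zero (fun n => norm_nonneg _) (fun n => norm_pow_sub_pow_le
      (norm_integral_le_one fun ω => (norm_expI _).le)
      (norm_integral_le_one fun ω => (norm_expI _).le) _)
      (tendsto_mul_norm_integral_expI_sub_sub hU1 hR1 hT hU2 hvar hT2 hT0 hTvar htail)
  have hprod : (fun n => ∏ i ∈ Finset.Icc 1 (M n), ∫ ω, expI (U n i ω - R n i ω) ∂μ)
      =ᶠ[atTop] fun n => (∫ ω, expI (U n 1 ω - R n 1 ω) ∂μ) ^ M n := by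
    filter_upwards [hid] with n hn
    have : ∀ i ∈ Finset.Icc 1 (M n), ∫ ω, expI (U n i ω - R n i ω) ∂μ
        = ∫ ω, expI (U n 1 ω - R n 1 ω) ∂μ := fun i hi => by
      have hm : Measurable fun z : ℝ × ℝ => expI (z.1 - z.2) :=
        measurable_expI.comp (measurable_fst.sub measurable_snd)
      exact ((hn i hi).comp hm).integral_eq
    rw [Finset.prod_congr rfl this]
    simp
  -- For real a, b, |exp(ia) - exp(i(a - b))| = |exp(ib) - 1|. Removing the sum of `R` thus costs
  -- only its L¹ distance from 1, with no independence from the other sum.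
  have hsumR : Tendsto (fun n => ∫ ω, expI (∑ i ∈ Finset.Icc 1 (M n), U n i ω) ∂μ
      - ∫ ω, ∏ i ∈ Finset.Icc 1 (M n), expI (U n i ω - R n i ω) ∂μ) atTop (𝓝 0) := by
    have h1 := tendsto_integral_norm_expI_sum_sub_one hk hR
      (hid.mono fun n hn i hi => (hn i hi).comp measurable_snd)
      (tendsto_mul_norm_integral_expI_sub_one hR1 hT hT2 hT0 hTvar htail) hmixR
    rw [tendsto_zero_iff_norm_tendsto_zero]
    refine squeeze_zero' (Eventually.of_forall fun n => norm_nonneg _) ?_ h1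
    filter_upwards [hU, hR] with n hUn hRn
    have mU : Measurable fun ω => ∑ i ∈ Finset.Icc 1 (M n), U n i ω :=
      Finset.measurable_fun_sum _ hUn
    have mR : Measurable fun ω => ∑ i ∈ Finset.Icc 1 (M n), R n i ω :=
      Finset.measurable_fun_sum _ hRn
    have e : ∀ ω, ∏ i ∈ Finset.Icc 1 (M n), expI (U n i ω - R n i ω)
        = expI (∑ i ∈ Finset.Icc 1 (M n), U n i ω - ∑ i ∈ Finset.Icc 1 (M n), R n i ω) :=
      fun ω => by rw [← expI_sum, Finset.sum_sub_distrib]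
    simp_rw [e]
    have mD : Measurable fun ω => ∑ i ∈ Finset.Icc 1 (M n), U n i ω
        - ∑ i ∈ Finset.Icc 1 (M n), R n i ω := mU.sub mR
    rw [← integral_sub (integrable_expI mU.aemeasurable) (integrable_expI mD.aemeasurable)]
    refine norm_integral_le_of_norm_le
      ((integrable_expI mR.aemeasurable).sub (integrable_const _)).norm (ae_of_all _ fun ω => ?_)
    set a := ∑ i ∈ Finset.Icc 1 (M n), U n i ω
    set b := ∑ i ∈ Finset.Icc 1 (M n), R n i ω
    have : expI a - expI (a - b) = expI (a - b) * (expI b - 1) := by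
      rw [mul_sub, ← expI_add]; simp
    rw [this, norm_mul, norm_expI, one_mul]
  have hpow'' := hpow'.add hpow
  simp only [sub_add_cancel] at hpow''
  have h2 := (tendsto_zero_iff_norm_tendsto_zero.2 hmixU).add (hpow''.congr' hprod.symm)
  have h3 := hsumR.add h2
  simpa using h3

end BlockCLT

/-! ### Moments and Lindeberg functionals of linear combinations. -/

section LinearCombinations

variable {Ω ι : Type*} [MeasurableSpace Ω] {μ : Measure Ω} [Fintype ι] (t : ι → ℝ)
  {x : ι → Ω → ℝ}

lemma memLp_sum_mul (hx : ∀ g, MemLp (x g) 2 μ) : MemLp (fun ω => ∑ g, t g * x g ω) 2 μ :=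
  memLp_finsetSum _ fun g _ => (hx g).const_mul (t g)

lemma integral_sum_mul_eq_zero (hx : ∀ g, Integrable (x g) μ) (hx0 : ∀ g, ∫ ω, x g ω ∂μ = 0) :
    ∫ ω, ∑ g, t g * x g ω ∂μ = 0 := by
  rw [integral_finsetSum _ fun g _ => (hx g).const_mul (t g)]
  simp [integral_const_mul, hx0]

lemma integral_sum_mul_sq (hx : ∀ g, MemLp (x g) 2 μ) :
    ∫ ω, (∑ g, t g * x g ω) ^ 2 ∂μ = ∑ g, ∑ h, t g * t h * ∫ ω, x g ω * x h ω ∂μ := by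
  have hi : ∀ g h, Integrable (fun ω => t g * t h * (x g ω * x h ω)) μ := fun g h =>
    ((hx g).integrable_mul (hx h)).const_mul _
  have e : ∀ ω, (∑ g, t g * x g ω) ^ 2 = ∑ g, ∑ h, t g * t h * (x g ω * x h ω) := fun ω => by
    rw [sq, Finset.sum_mul_sum]
    exact Finset.sum_congr rfl fun g _ => Finset.sum_congr rfl fun h _ => by ring
  simp_rw [e]
  rw [integral_finsetSum _ fun g _ => integrable_finsetSum _ fun h _ => hi g h]
  refine Finset.sum_congr rfl fun g _ => ?_
  rw [integral_finsetSum _ fun h _ => hi g h]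
  exact Finset.sum_congr rfl fun h _ => integral_const_mul _ _

lemma integral_sum_mul_sq_le (hx : ∀ g, MemLp (x g) 2 μ) :
    ∫ ω, (∑ g, t g * x g ω) ^ 2 ∂μ ≤ (∑ g, t g ^ 2) * ∑ g, ∫ ω, x g ω ^ 2 ∂μ := by
  have hi : Integrable (fun ω => ∑ g, x g ω ^ 2) μ :=
    integrable_finsetSum _ fun g _ => (hx g).integrable_sq
  rw [← integral_finsetSum _ fun g _ => (hx g).integrable_sq, ← integral_const_mul]
  exact integral_mono (memLp_sum_mul t hx).integrable_sq (hi.const_mul _) fun ω =>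
    Finset.sum_mul_sq_le_sq_mul_sq _ _ _

/-- The Lindeberg functional of a linear combination. -/
lemma setIntegral_sum_mul_sq_le (hxm : ∀ g, Measurable (x g)) (hx : ∀ g, MemLp (x g) 2 μ)
    {ε : ℝ} (hε : 0 < ε) :
    ∫ ω in {ω | ε < |∑ g, t g * x g ω|}, (∑ g, t g * x g ω) ^ 2 ∂μ
      ≤ (∑ g, |t g| + 1) ^ 2 *
        ∑ g, ∫ ω in {ω | ε / (∑ g, |t g| + 1) < |x g ω|}, x g ω ^ 2 ∂μ := by
  -- The added 1 keeps `K` positive even when all coefficients vanish.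
  set K := ∑ g, |t g| + 1 with hK
  have hK0 : 0 < K := by positivity
  have hS : MeasurableSet {ω | ε < |∑ g, t g * x g ω|} :=
    measurableSet_lt measurable_const
      (Finset.measurable_fun_sum _ fun g _ => (hxm g).const_mul _).abs
  have hSg : ∀ g, MeasurableSet {ω | ε / K < |x g ω|} := fun g =>
    measurableSet_lt measurable_const (hxm g).abs
  have hi : ∀ g, Integrable ({ω | ε / K < |x g ω|}.indicator fun ω => x g ω ^ 2) μ := fun g =>
    (hx g).integrable_sq.indicator (hSg g)
  rw [← integral_indicator hS]
  simp_rw [fun g => (integral_indicator (μ := μ) (f := fun ω => x g ω ^ 2) (hSg g)).symm]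
  rw [← integral_finsetSum _ fun g _ => hi g, ← integral_const_mul]
  refine integral_mono ((memLp_sum_mul t hx).integrable_sq.indicator hS)
    ((integrable_finsetSum _ fun g _ => hi g).const_mul _) fun ω => ?_
  have hnn : ∀ g, 0 ≤ {ω | ε / K < |x g ω|}.indicator (fun ω => x g ω ^ 2) ω := fun g =>
    Set.indicator_nonneg (fun _ _ => sq_nonneg _) _
  by_cases h : ω ∈ {ω | ε < |∑ g, t g * x g ω|}
  swap
  · rw [Set.indicator_of_notMem h]
    exact mul_nonneg (by positivity) (Finset.sum_nonneg fun g _ => hnn g)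
  rw [Set.indicator_of_mem h]
  rw [Set.mem_ofPred_eq] at h
  have hne : (Finset.univ : Finset ι).Nonempty := by
    by_contra hemp
    rw [Finset.not_nonempty_iff_eq_empty] at hemp
    rw [hemp] at h
    simp at h
    linarith
  -- The largest coordinate dominates the sum up to the factor `K`; hence it exceeds ε / K as soon
  -- as the sum exceeds ε.
  obtain ⟨g₀, -, hg₀⟩ := Finset.exists_max_image Finset.univ (fun g => |x g ω|) hne
  have hle : |∑ g, t g * x g ω| ≤ K * |x g₀ ω| := by
    calc |∑ g, t g * x g ω| ≤ ∑ g, |t g * x g ω| := Finset.abs_sum_le_sum_abs _ _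
      _ ≤ ∑ g, |t g| * |x g₀ ω| := Finset.sum_le_sum fun g _ => by
          rw [abs_mul]
          exact mul_le_mul_of_nonneg_left (hg₀ g (Finset.mem_univ g)) (abs_nonneg _)
      _ = (∑ g, |t g|) * |x g₀ ω| := by rw [Finset.sum_mul]
      _ ≤ K * |x g₀ ω| := by gcongr; linarith
  have hmem : ω ∈ {ω | ε / K < |x g₀ ω|} := by
    rw [Set.mem_ofPred_eq, div_lt_iff₀' hK0]
    exact h.trans_le hle
  calc (∑ g, t g * x g ω) ^ 2 = |∑ g, t g * x g ω| ^ 2 := (sq_abs _).symm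
    _ ≤ (K * |x g₀ ω|) ^ 2 := by gcongr
    _ = K ^ 2 * {ω | ε / K < |x g₀ ω|}.indicator (fun ω => x g₀ ω ^ 2) ω := by
        rw [Set.indicator_of_mem hmem, mul_pow, sq_abs]
    _ ≤ K ^ 2 * ∑ g, {ω | ε / K < |x g ω|}.indicator (fun ω => x g ω ^ 2) ω := by
        gcongr
        exact Finset.single_le_sum (fun g _ => hnn g) (Finset.mem_univ g₀)

end LinearCombinations

/-! ### Block geometry, normalization and truncation. -/

section Blocks

lemma tendsto_zero_of_ofReal_le {f : ℕ → ℝ} {b : ℕ → ℝ≥0∞} (hf : ∀ n, 0 ≤ f n)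
    (hb : Tendsto b atTop (𝓝 0)) (h : ∀ᶠ n in atTop, ENNReal.ofReal (f n) ≤ b n) :
    Tendsto f atTop (𝓝 0) := by
  have h1 : Tendsto (fun n => ENNReal.ofReal (f n)) atTop (𝓝 0) :=
    tendsto_of_tendsto_of_tendsto_of_le_of_le' tendsto_const_nhds hb
      (Eventually.of_forall fun _ => zero_le) h
  have h2 := (ENNReal.tendsto_toReal ENNReal.zero_ne_top).comp h1
  simpa [Function.comp_def, ENNReal.toReal_ofReal (hf _)] using h2

variable {Ω : Type u} [MeasurableSpace Ω] {μ : Measure Ω} {E : Type v} [MeasurableSpace E]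
  {𝓖 : Type w} {X : ℕ → ℕ → Ω → E} {s r : ℕ → ℕ} {V V' : ℕ → ℕ → 𝓖 → Ω → ℝ}

lemma StationaryUpTo.identDistrib {S : Type*} [MeasurableSpace S] {ξ : ℕ → Ω → S} {N i : ℕ}
    (h : StationaryUpTo μ ξ N) (hi : i ∈ Finset.Icc 1 N) : IdentDistrib (ξ i) (ξ 1) μ μ := by
  rw [Finset.mem_Icc] at hi
  have h1 := h (i - 1) (by omega)
  have h2 := h1.comp (measurable_pi_apply (⟨0, by omega⟩ : Fin (N - (i - 1))))
  simp only [Function.comp_def, zero_add] at h2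
  rw [show 1 + (i - 1) = i by omega] at h2
  exact h2.symm

namespace CondA

variable (hA : CondA μ X s r)
include hA

/-- The truncated subtraction in `numBlocks` does no harm: a block can exist only if `n + 1 - s n`
is positive. -/
lemma mul_add_sub_le {n i : ℕ} (hi : i ∈ Set.Icc 1 (numBlocks s r n)) :
    i * r n + s n - 1 ≤ n := by
  have h1 : numBlocks s r n * r n ≤ n + 1 - s n := Nat.div_mul_le_self _ _
  have h2 : i * r n ≤ numBlocks s r n * r n := Nat.mul_le_mul_right _ hi.2
  have h3 : 1 * 1 ≤ i * r n := Nat.mul_le_mul hi.1 (hA.r_pos n)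
  omega

lemma eventually_s_le_r : ∀ᶠ n in atTop, s n ≤ r n := by
  filter_upwards [hA.s_littleO.bound one_pos] with n hn
  have : (s n : ℝ) ≤ r n := by simpa using hn
  exact_mod_cast this

lemma tendsto_numBlocks : Tendsto (numBlocks s r) atTop atTop := by
  refine tendsto_atTop.2 fun K => ?_
  -- With `2 * (K + 1) * r n ≤ n` and `s n ≤ r n` there is room for `K` blocks and the overhang `s
  -- n`.
  have hpos : (0 : ℝ) < 1 / (2 * (K + 1)) := by positivity
  filter_upwards [hA.eventually_s_le_r, hA.r_littleO.bound hpos] with n h1 h2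
  have h3 : (r n : ℝ) ≤ 1 / (2 * (K + 1)) * n := by simpa using h2
  have h4 : 2 * ((K : ℝ) + 1) * r n ≤ n := by
    have : 2 * ((K : ℝ) + 1) * r n ≤ 2 * (K + 1) * (1 / (2 * (K + 1)) * n) := by gcongr
    refine this.trans_eq ?_
    field_simp
  have h5 : 2 * (K + 1) * r n ≤ n := by exact_mod_cast h4
  rw [numBlocks, Nat.le_div_iff_mul_le (hA.r_pos n)]
  have h6 : 2 * (K + 1) * r n = 2 * (K * r n) + 2 * r n := by ring
  omega

end CondA

section Measurability

variable (hX : ∀ n, ∀ i ∈ Set.Icc 1 n, Measurable (X n i)) (hA : CondA μ X s r)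
  (hV : CondV μ X s r V V')
include hX hA hV

lemma measurable_block {n i : ℕ} (hi : i ∈ Set.Icc 1 (numBlocks s r n)) (g : 𝓖) :
    Measurable (V n i g) :=
  (hV.measurable n i hi g).mono (sigmaField_le fun l hl => hX n l
    ⟨by have := hl.1; omega, hl.2.trans (hA.mul_add_sub_le hi)⟩) le_rfl

lemma measurable_block' {n i : ℕ} (hi : i ∈ Set.Icc 1 (numBlocks s r n)) (g : 𝓖) :
    Measurable (V' n i g) :=
  (hV.measurable' n i hi g).mono (sigmaField_le fun l hl => hX n l
    ⟨by have := hl.1; omega, hl.2.trans (hA.mul_add_sub_le hi)⟩) le_rfl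

end Measurability

/-- The contribution of the block `i` to `Z_n(g)`. -/
noncomputable def normBlock (μ : Measure Ω) (V : ℕ → ℕ → 𝓖 → Ω → ℝ) (n i : ℕ) (g : 𝓖) (ω : Ω) : ℝ :=
  (√(blockProb μ V n))⁻¹ * (V n i g ω - ∫ ω', V n 1 g ω' ∂μ)

/-- The normalized difference between the two processes on the block `i`. -/
noncomputable def normDiff (μ : Measure Ω) (V V' : ℕ → ℕ → 𝓖 → Ω → ℝ) (n i : ℕ) (g : 𝓖) (ω : Ω) :
    ℝ :=
  (√(blockProb μ V n))⁻¹ * ((V n i g ω - V' n i g ω) - ∫ ω', (V n 1 g ω' - V' n 1 g ω') ∂μ)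

/-- The truncation of `normDiff` on the first block at level one. -/
noncomputable def truncDiff (μ : Measure Ω) (V V' : ℕ → ℕ → 𝓖 → Ω → ℝ) (n : ℕ) (g : 𝓖) (ω : Ω) :
    ℝ :=
  if |normDiff μ V V' n 1 g ω| ≤ 1 then normDiff μ V V' n 1 g ω else 0

lemma inv_sqrt_mul_abs_le_iff {p a ε : ℝ} (hp : 0 < p) :
    |(√p)⁻¹ * a| ≤ ε ↔ |a| ≤ ε * √p := by
  have h : 0 < √p := Real.sqrt_pos.2 hp
  rw [abs_mul, abs_inv, abs_of_pos h, inv_mul_le_iff₀ h, mul_comm]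

lemma inv_sqrt_mul_sq {p : ℝ} (hp : 0 ≤ p) (a : ℝ) : ((√p)⁻¹ * a) ^ 2 = p⁻¹ * a ^ 2 := by
  rw [mul_pow, inv_pow, Real.sq_sqrt hp]

lemma blockProb_nonneg (n : ℕ) : 0 ≤ blockProb μ V n := measureReal_nonneg

section FirstBlock

variable {n : ℕ} {g : 𝓖}

lemma abs_truncDiff_le (ω : Ω) : |truncDiff μ V V' n g ω| ≤ 1 := by
  rw [truncDiff]
  split_ifs with h
  · exact h
  · simp

lemma measurable_truncDiff (h : Measurable (normDiff μ V V' n 1 g)) :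
    Measurable (truncDiff μ V V' n g) :=
  Measurable.ite (measurableSet_le h.abs measurable_const) h measurable_const

lemma memLp_truncDiff [IsFiniteMeasure μ] (h : Measurable (normDiff μ V V' n 1 g)) :
    MemLp (truncDiff μ V V' n g) 2 μ :=
  .of_bound (measurable_truncDiff h).aestronglyMeasurable 1 (ae_of_all _ abs_truncDiff_le)

lemma integral_truncDiff_sq (hp : 0 < blockProb μ V n)
    (h : Measurable (normDiff μ V V' n 1 g)) :
    ∫ ω, truncDiff μ V V' n g ω ^ 2 ∂μ = (blockProb μ V n)⁻¹ *
      ∫ ω in {ω | |(V n 1 g ω - V' n 1 g ω)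
        - ∫ ω', (V n 1 g ω' - V' n 1 g ω') ∂μ| ≤ √(blockProb μ V n)},
      ((V n 1 g ω - V' n 1 g ω) - ∫ ω', (V n 1 g ω' - V' n 1 g ω') ∂μ) ^ 2 ∂μ := by
  have hset : {ω | |(V n 1 g ω - V' n 1 g ω)
        - ∫ ω', (V n 1 g ω' - V' n 1 g ω') ∂μ| ≤ √(blockProb μ V n)}
      = {ω | |normDiff μ V V' n 1 g ω| ≤ 1} := by
    ext ω
    simp only [Set.mem_ofPred_eq, normDiff]
    rw [inv_sqrt_mul_abs_le_iff hp, one_mul]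
  rw [hset, ← integral_const_mul, ← integral_indicator (measurableSet_le h.abs measurable_const)]
  refine integral_congr_ae (ae_of_all _ fun ω => ?_)
  by_cases hω : |normDiff μ V V' n 1 g ω| ≤ 1
  · simp only [truncDiff, if_pos hω]
    rw [Set.indicator_of_mem (by exact hω), normDiff, inv_sqrt_mul_sq hp.le]
  · simp only [truncDiff, if_neg hω]
    rw [Set.indicator_of_notMem (by exact hω)]
    norm_num

/-- Truncation destroys the centering; restoring it can only lower the second moment. -/
lemma integral_truncDiff_sub_sq_le [IsProbabilityMeasure μ]
    (h : Measurable (normDiff μ V V' n 1 g)) :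
    ∫ ω, (truncDiff μ V V' n g ω - ∫ ω', truncDiff μ V V' n g ω' ∂μ) ^ 2 ∂μ
      ≤ ∫ ω, truncDiff μ V V' n g ω ^ 2 ∂μ := by
  rw [← variance_eq_integral (measurable_truncDiff h).aemeasurable]
  exact variance_le_expectation_sq (measurable_truncDiff h).aestronglyMeasurable

lemma setIntegral_normBlock_sq (hp : 0 < blockProb μ V n) (ε : ℝ) :
    ∫ ω in {ω | ε < |normBlock μ V n 1 g ω|}, normBlock μ V n 1 g ω ^ 2 ∂μ
      = (blockProb μ V n)⁻¹ *
        ∫ ω in {ω | ε * √(blockProb μ V n) < |V n 1 g ω - ∫ ω', V n 1 g ω' ∂μ|},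
      (V n 1 g ω - ∫ ω', V n 1 g ω' ∂μ) ^ 2 ∂μ := by
  have hset : {ω | ε < |normBlock μ V n 1 g ω|}
      = {ω | ε * √(blockProb μ V n) < |V n 1 g ω - ∫ ω', V n 1 g ω' ∂μ|} := by
    ext ω
    simp only [Set.mem_ofPred_eq, normBlock]
    rw [← not_le, inv_sqrt_mul_abs_le_iff hp, not_le]
  rw [hset, ← integral_const_mul]
  simp only [normBlock, inv_sqrt_mul_sq hp.le]

lemma integral_normBlock_mul (g h : 𝓖) :
    ∫ ω, normBlock μ V n 1 g ω * normBlock μ V n 1 h ω ∂μ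
      = (blockProb μ V n)⁻¹ * cov[V n 1 g, V n 1 h; μ] := by
  rw [covariance, ← integral_const_mul]
  refine integral_congr_ae (ae_of_all _ fun ω => ?_)
  have : (√(blockProb μ V n))⁻¹ * (√(blockProb μ V n))⁻¹ = (blockProb μ V n)⁻¹ := by
    rw [← mul_inv, Real.mul_self_sqrt (blockProb_nonneg n)]
  simp only [normBlock]
  rw [← this]
  ring

end FirstBlock

end Blocks

/-! ### Convergence of the finite-dimensional characteristic functions. -/

section FiniteDimensional

variable {Ω : Type u} [MeasurableSpace Ω] {μ : Measure Ω} {E : Type v}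
  [MeasurableSpace E] {𝓖 : Type w} {X : ℕ → ℕ → Ω → E} {s r : ℕ → ℕ} {V V' : ℕ → ℕ → 𝓖 → Ω → ℝ}
  {c : 𝓖 → 𝓖 → ℝ}

lemma CondV.identDistrib (hV : CondV μ X s r V V') {n i : ℕ}
    (hi : i ∈ Finset.Icc 1 (numBlocks s r n)) :
    IdentDistrib (fun ω => fun g : 𝓖 => (V n i g ω, V' n i g ω))
      (fun ω => fun g : 𝓖 => (V n 1 g ω, V' n 1 g ω)) μ μ :=
  (hV.stationary n).identDistrib hi

/-- By stationarity all blocks have the mean of the first one. Centering at that common mean makes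
every normalized block the same measurable function of its process. -/
lemma empProcess_eq_sum_normBlock (hV : CondV μ X s r V V') (n : ℕ) (g : 𝓖) (ω : Ω) :
    empProcess μ s r V n g ω = ∑ i ∈ Finset.Icc 1 (numBlocks s r n), normBlock μ V n i g ω := by
  rw [empProcess, Finset.mul_sum]
  refine Finset.sum_congr rfl fun i hi => ?_
  have hm : Measurable fun z : 𝓖 → ℝ × ℝ => (z g).1 := (measurable_pi_apply g).fst
  have := ((hV.identDistrib hi).comp hm).integral_eq
  simp only [Function.comp_def] at this
  rw [normBlock, this]

lemma tendsto_mul_integral_truncDiff_sq (hΔ : CondDelta μ s r V V')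
    (hp : ∀ᶠ n in atTop, 0 < blockProb μ V n) {g : 𝓖}
    (hD : ∀ᶠ n in atTop, Measurable (normDiff μ V V' n 1 g)) :
    Tendsto (fun n => (numBlocks s r n : ℝ) * ∫ ω, truncDiff μ V V' n g ω ^ 2 ∂μ) atTop
      (𝓝 0) := by
  refine ((hΔ.truncated g).tendsto_div_nhds_zero).congr' ?_
  filter_upwards [hp, hD] with n hn hDn
  rw [integral_truncDiff_sq hn hDn, div_div_eq_mul_div]
  field_simp

lemma tendsto_mul_measureReal_normDiff (hΔ : CondDelta μ s r V V')
    (hp : ∀ᶠ n in atTop, 0 < blockProb μ V n) (g : 𝓖) :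
    Tendsto (fun n => (numBlocks s r n : ℝ) * μ.real {ω | 1 < |normDiff μ V V' n 1 g ω|}) atTop
      (𝓝 0) := by
  refine ((hΔ.tail g).tendsto_div_nhds_zero).congr' ?_
  filter_upwards [hp] with n hn
  have hset : {ω | 1 < |normDiff μ V V' n 1 g ω|}
      = {ω | √(blockProb μ V n) < |(V n 1 g ω - V' n 1 g ω)
        - ∫ ω', (V n 1 g ω' - V' n 1 g ω') ∂μ|} := by
    ext ω
    simp only [Set.mem_ofPred_eq, normDiff]
    rw [← not_le, inv_sqrt_mul_abs_le_iff hn, not_le, one_mul]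
  rw [hset, div_div_eq_mul_div, div_one, mul_comm]

lemma tendsto_mul_setIntegral_normBlock_sq (hL : CondL μ s r V)
    (hp : ∀ᶠ n in atTop, 0 < blockProb μ V n) (g : 𝓖) {ε : ℝ} (hε : 0 < ε) :
    Tendsto (fun n => (numBlocks s r n : ℝ) *
      ∫ ω in {ω | ε < |normBlock μ V n 1 g ω|}, normBlock μ V n 1 g ω ^ 2 ∂μ) atTop (𝓝 0) := by
  refine ((hL.lindeberg g ε hε).tendsto_div_nhds_zero).congr' ?_
  filter_upwards [hp] with n hn
  rw [setIntegral_normBlock_sq hn, div_div_eq_mul_div]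
  field_simp

lemma memLp_normBlock [IsFiniteMeasure μ] {n i : ℕ} {g : 𝓖} (h : MemLp (V n i g) 2 μ) :
    MemLp (normBlock μ V n i g) 2 μ :=
  (h.sub (memLp_const _)).const_mul _

lemma integral_normBlock [IsProbabilityMeasure μ] {n : ℕ} {g : 𝓖} (h : Integrable (V n 1 g) μ) :
    ∫ ω, normBlock μ V n 1 g ω ∂μ = 0 := by
  simp only [normBlock]
  rw [integral_const_mul, integral_sub h (integrable_const _)]
  simp

section Variance

variable [IsProbabilityMeasure μ] (hC : CondC μ s r V c)
include hC

lemma CondC.tendsto_variance (I : Finset 𝓖) (t : I → ℝ) :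
    Tendsto (fun n => (numBlocks s r n : ℝ) *
      ∫ ω, (∑ g : I, t g * normBlock μ V n 1 g ω) ^ 2 ∂μ) atTop
      (𝓝 (∑ g : I, ∑ h : I, t g * t h * c g h)) := by
  have h1 : Tendsto (fun n => ∑ g : I, ∑ h : I, t g * t h *
      ((numBlocks s r n : ℝ) / blockProb μ V n * cov[V n 1 g, V n 1 h; μ])) atTop
      (𝓝 (∑ g : I, ∑ h : I, t g * t h * c g h)) :=
    tendsto_finsetSum _ fun g _ => tendsto_finsetSum _ fun h _ => (hC.tendsto g h).const_mul _
  refine h1.congr' ?_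
  have hmem : ∀ᶠ n in atTop, ∀ g : I, MemLp (V n 1 g) 2 μ :=
    eventually_all.2 fun g => hC.memLp g
  filter_upwards [hmem] with n hn
  rw [integral_sum_mul_sq t fun g : I => memLp_normBlock (hn g), Finset.mul_sum]
  refine Finset.sum_congr rfl fun g _ => ?_
  rw [Finset.mul_sum]
  refine Finset.sum_congr rfl fun h _ => ?_
  rw [integral_normBlock_mul]
  ring

/-- Quadratic forms of `c` are limits of second moments, hence nonnegative; symmetry passes to the
limit by uniqueness. -/
lemma CondC.posSemidef (I : Finset 𝓖) : (kernelMatrix c I).PosSemidef := by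
  refine Matrix.PosSemidef.of_dotProduct_mulVec_nonneg ?_ fun t => ?_
  · ext g h
    have h1 := hC.tendsto h g
    simp_rw [fun n => covariance_comm (μ := μ) (V n 1 h) (V n 1 g)] at h1
    simpa [kernelMatrix] using tendsto_nhds_unique h1 (hC.tendsto g h)
  · have h1 := ge_of_tendsto' (hC.tendsto_variance I t) (b := 0) fun n =>
      mul_nonneg (Nat.cast_nonneg _) (integral_nonneg fun ω => sq_nonneg _)
    refine h1.trans_eq ?_
    simp only [dotProduct, Matrix.mulVec, kernelMatrix, Matrix.of_apply, Finset.mul_sum]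
    refine Finset.sum_congr rfl fun g _ => Finset.sum_congr rfl fun h _ => ?_
    simp
    ring

end Variance

/-- Convergence of the characteristic functions of the finite-dimensional marginals. -/
theorem tendsto_integral_expI_sum_empProcess [IsProbabilityMeasure μ]
    (hX : ∀ n, ∀ i ∈ Set.Icc 1 n, Measurable (X n i))
    (hp : ∀ᶠ n in atTop, 0 < blockProb μ V n) (hA : CondA μ X s r) (hV : CondV μ X s r V V')
    (hMV : CondMV μ s r V') {k : ℕ} (hk : 2 ≤ k) (hMX : CondMX μ X s r k)
    (hΔ : CondDelta μ s r V V') (hL : CondL μ s r V) (hC : CondC μ s r V c)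
    (I : Finset 𝓖) (t : I → ℝ) :
    Tendsto (fun n => ∫ ω, expI (∑ g : I, t g * empProcess μ s r V n g ω) ∂μ) atTop
      (𝓝 (Complex.exp ((-((∑ g : I, ∑ h : I, t g * t h * c g h) / 2) : ℝ) : ℂ))) := by
  have hM := hA.tendsto_numBlocks
  have hM1 : ∀ᶠ n in atTop, 1 ∈ Set.Icc 1 (numBlocks s r n) := by
    filter_upwards [hM.eventually_ge_atTop 1] with n hn using ⟨le_rfl, hn⟩
  have hmB : ∀ {n i}, i ∈ Set.Icc 1 (numBlocks s r n) → ∀ g, Measurable (normBlock μ V n i g) :=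
    fun hi g => ((measurable_block hX hA hV hi g).sub_const _).const_mul _
  have hmD : ∀ {n i}, i ∈ Set.Icc 1 (numBlocks s r n) → ∀ g,
      Measurable (normDiff μ V V' n i g) := fun hi g =>
    (((measurable_block hX hA hV hi g).sub (measurable_block' hX hA hV hi g)).sub_const _).const_mul
      _
  have hmD1 : ∀ᶠ n in atTop, ∀ g, Measurable (normDiff μ V V' n 1 g) := by
    filter_upwards [hM1] with n hn using hmD hn
  have hmem : ∀ᶠ n in atTop, ∀ g : I, MemLp (V n 1 g) 2 μ :=
    eventually_all.2 fun g => hC.memLp g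
  -- The same shift α enters `R` and `T`: it centers `T`, keeps `R = T` where nothing is truncated,
  -- and, being deterministic, leaves `U - R` a function of Ṽ. No bound on m α is therefore needed.
  set α : ℕ → 𝓖 → ℝ := fun n g => ∫ ω, truncDiff μ V V' n g ω ∂μ with hα
  set U : ℕ → ℕ → Ω → ℝ := fun n i ω => ∑ g : I, t g * normBlock μ V n i g ω with hU
  set R : ℕ → ℕ → Ω → ℝ := fun n i ω => ∑ g : I, t g * (normDiff μ V V' n i g ω - α n g) with hR
  set T : ℕ → Ω → ℝ := fun n ω => ∑ g : I, t g * (truncDiff μ V V' n g ω - α n g) with hT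
  have hmU : ∀ {n i}, i ∈ Set.Icc 1 (numBlocks s r n) → Measurable (U n i) := fun hi =>
    Finset.measurable_fun_sum _ fun g _ => (hmB hi g).const_mul _
  have hmR : ∀ {n i}, i ∈ Set.Icc 1 (numBlocks s r n) → Measurable (R n i) := fun hi =>
    Finset.measurable_fun_sum _ fun g _ => ((hmD hi g).sub_const _).const_mul _
  have hmemT : ∀ᶠ n in atTop, ∀ g, MemLp (fun ω => truncDiff μ V V' n g ω - α n g) 2 μ := by
    filter_upwards [hmD1] with n hn g using (memLp_truncDiff (hn g)).sub (memLp_const _)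
  have e : ∀ n ω, ∑ g : I, t g * empProcess μ s r V n g ω
      = ∑ i ∈ Finset.Icc 1 (numBlocks s r n), U n i ω := fun n ω => by
    simp only [empProcess_eq_sum_normBlock hV, Finset.mul_sum, hU]
    exact Finset.sum_comm
  simp_rw [e]
  refine tendsto_integral_expI_sum (k := k) (R := R) (T := T) (by omega) hM
    (Eventually.of_forall fun n i hi => hmU (Finset.mem_Icc.1 hi))
    (Eventually.of_forall fun n i hi => hmR (Finset.mem_Icc.1 hi)) ?_ ?_ ?_
    (hC.tendsto_variance I t) ?_ ?_ ?_ ?_ ?_ ?_ ?_ ?_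
  · refine Eventually.of_forall fun n i hi => ?_
    have hm : Measurable fun z : 𝓖 → ℝ × ℝ =>
        (∑ g : I, t g * ((√(blockProb μ V n))⁻¹ * ((z g).1 - ∫ ω', V n 1 g ω' ∂μ)),
          ∑ g : I, t g * ((√(blockProb μ V n))⁻¹ * (((z g).1 - (z g).2)
            - ∫ ω', (V n 1 g ω' - V' n 1 g ω') ∂μ) - α n g)) := by
      fun_prop
    exact (hV.identDistrib hi).comp hm
  · filter_upwards [hmem] with n hn using memLp_sum_mul t fun g => memLp_normBlock (hn g)
  · filter_upwards [hmem] with n hn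
    exact integral_sum_mul_eq_zero t
      (fun g => (memLp_normBlock (hn g)).integrable (by norm_num))
      (fun g => integral_normBlock ((hn g).integrable (by norm_num)))
  · intro ε hε
    set K := ∑ g : I, |t g| + 1 with hK
    have hK0 : 0 < K := by positivity
    have h1 : Tendsto (fun n => K ^ 2 * ∑ g : I, (numBlocks s r n : ℝ) *
        ∫ ω in {ω | ε / K < |normBlock μ V n 1 g ω|}, normBlock μ V n 1 g ω ^ 2 ∂μ) atTop
        (𝓝 0) := by
      simpa using (tendsto_finsetSum Finset.univ fun (g : I) _ =>
        tendsto_mul_setIntegral_normBlock_sq hL hp g (div_pos hε hK0)).const_mul (K ^ 2)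
    refine squeeze_zero' (Eventually.of_forall fun n => mul_nonneg (Nat.cast_nonneg _)
      (integral_nonneg fun ω => sq_nonneg _)) ?_ h1
    filter_upwards [hmem, hM1] with n hn h1n
    have := mul_le_mul_of_nonneg_left (setIntegral_sum_mul_sq_le (μ := μ) t
      (x := fun g : I => normBlock μ V n 1 g) (fun g => hmB h1n g)
      (fun g => memLp_normBlock (hn g)) hε) (Nat.cast_nonneg (α := ℝ) (numBlocks s r n))
    refine this.trans_eq ?_
    rw [← Finset.mul_sum]
    ring
  · filter_upwards [hmD1] with n hn
    exact Finset.measurable_fun_sum _ fun g _ =>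
      ((measurable_truncDiff (hn g)).sub_const _).const_mul _
  · filter_upwards [hmemT] with n hn using memLp_sum_mul t fun g => hn g
  · filter_upwards [hmemT, hmD1] with n hn hDn
    refine integral_sum_mul_eq_zero t (fun g => (hn g).integrable (by norm_num)) fun g => ?_
    rw [integral_sub ((memLp_truncDiff (hDn g)).integrable (by norm_num)) (integrable_const _)]
    simp [hα]
  · have h1 : Tendsto (fun n => (∑ g : I, t g ^ 2) * ∑ g : I, (numBlocks s r n : ℝ) *
        ∫ ω, truncDiff μ V V' n g ω ^ 2 ∂μ) atTop (𝓝 0) := by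
      simpa using (tendsto_finsetSum Finset.univ fun (g : I) _ =>
        tendsto_mul_integral_truncDiff_sq hΔ hp
          (hmD1.mono fun n hn => hn g)).const_mul (∑ g : I, t g ^ 2)
    refine squeeze_zero' (Eventually.of_forall fun n => mul_nonneg (Nat.cast_nonneg _)
      (integral_nonneg fun ω => sq_nonneg _)) ?_ h1
    filter_upwards [hmemT, hmD1] with n hn hDn
    have h2 := (integral_sum_mul_sq_le (μ := μ) t fun g : I => hn g).trans
      (mul_le_mul_of_nonneg_left (Finset.sum_le_sum fun (g : I) _ =>
        integral_truncDiff_sub_sq_le (hDn g)) (by positivity))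
    refine (mul_le_mul_of_nonneg_left h2
      (Nat.cast_nonneg (α := ℝ) (numBlocks s r n))).trans_eq ?_
    rw [← Finset.mul_sum]
    ring
  · have h1 : Tendsto (fun n => ∑ g : I, (numBlocks s r n : ℝ) *
        μ.real {ω | 1 < |normDiff μ V V' n 1 g ω|}) atTop (𝓝 0) := by
      simpa using tendsto_finsetSum Finset.univ fun (g : I) _ =>
        tendsto_mul_measureReal_normDiff hΔ hp (g : 𝓖)
    refine squeeze_zero (fun n => by positivity) (fun n => ?_) h1
    rw [← Finset.mul_sum]
    refine mul_le_mul_of_nonneg_left ?_ (Nat.cast_nonneg _)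
    refine le_trans (measureReal_mono ?_) (measureReal_iUnion_fintype_le
      fun g : I => {ω | 1 < |normDiff μ V V' n 1 g ω|})
    intro ω hω
    by_contra hnot
    simp only [Set.mem_iUnion, Set.mem_ofPred_eq, not_exists, not_lt] at hnot
    refine hω (Finset.sum_congr rfl fun g _ => ?_)
    rw [truncDiff, if_pos (hnot g)]
  · have hb : Tendsto (fun n => (numBlocks s r n : ℝ≥0∞) * (16 *
        betaMixing μ (fun i ω => fun g : 𝓖 => V' n i g ω) (numBlocks s r n) 0)) atTop (𝓝 0) := by
      have := ENNReal.Tendsto.const_mul (a := 16) hMV (Or.inr (by norm_num))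
      rw [mul_zero] at this
      exact this.congr fun n => by ring
    refine tendsto_zero_of_ofReal_le (fun n => norm_nonneg _) hb (Eventually.of_forall fun n => ?_)
    refine ofReal_norm_integral_prod_sub_le_betaMixing
      (fun i hi => measurable_pi_iff.2 fun g => measurable_block' hX hA hV hi g)
      (fun i ω => (norm_expI _).le) fun i hi => ?_
    -- In `U - R` the values of V cancel, so each factor is a function of the process Ṽ on its block
    -- and mixing of Ṽ at gap 0 applies.
    have hm : Measurable fun z : 𝓖 → ℝ => expI (∑ g : I, t g * ((√(blockProb μ V n))⁻¹ *
        (z g - ∫ ω', V n 1 g ω' ∂μ + ∫ ω', (V n 1 g ω' - V' n 1 g ω') ∂μ) + α n g)) := by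
      fun_prop
    have hcomp : (fun ω => expI (U n i ω - R n i ω)) = (fun z : 𝓖 → ℝ => expI (∑ g : I,
        t g * ((√(blockProb μ V n))⁻¹ * (z g - ∫ ω', V n 1 g ω' ∂μ
          + ∫ ω', (V n 1 g ω' - V' n 1 g ω') ∂μ) + α n g))) ∘
          fun ω => fun g : 𝓖 => V' n i g ω := by
      funext ω
      simp only [hU, hR, Function.comp_apply, ← Finset.sum_sub_distrib]
      congr 1
      refine Finset.sum_congr rfl fun g _ => ?_
      rw [normBlock, normDiff]
      ring
    rw [hcomp]
    exact hm.comp (comap_measurable _)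
  -- `R` involves both V and Ṽ, so its factors are only known to be measurable with respect to the
  -- overlapping X-blocks; hence the residue classes and the mixing of X.
  · intro j
    have hb : Tendsto (fun n => (numBlocks s r n : ℝ≥0∞) * (16 *
        betaMixing μ (X n) n ((k - 1) * r n - s n))) atTop (𝓝 0) := by
      have := ENNReal.Tendsto.const_mul (a := 16) hMX (Or.inr (by norm_num))
      rw [mul_zero] at this
      exact this.congr fun n => by ring
    refine tendsto_zero_of_ofReal_le (fun n => norm_nonneg _) hb ?_
    filter_upwards [hM1, hA.eventually_s_le_r] with n h1n hsr
    refine ofReal_norm_integral_prod_residue_sub_le_betaMixing (hA.s_pos n) (hA.r_pos n) hk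
      (hsr.trans (Nat.le_mul_of_pos_left _ (by omega)))
      (hA.mul_add_sub_le ⟨h1n.2, le_rfl⟩) (hX n) (fun i ω => (norm_expI _).le) (fun i hi => ?_) j
    refine measurable_expI.comp (Finset.measurable_fun_sum _ fun g _ => ?_)
    exact ((((hV.measurable n i hi g).sub (hV.measurable' n i hi g)).sub_const _).const_mul
      _ |>.sub_const _).const_mul _

end FiniteDimensional

end BlockArray

/-! ### The limit theorem for the empirical process. -/

theorem theoremA1 {Ω : Type u} [MeasurableSpace Ω] (μ : Measure Ω) [IsProbabilityMeasure μ]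
    {E : Type v} [NormedAddCommGroup E] [NormedSpace ℝ E] [CompleteSpace E]
    [MeasurableSpace E] [BorelSpace E] {𝓖 : Type w}
    (X : ℕ → ℕ → Ω → E) (hX : ∀ n, ∀ i ∈ Set.Icc 1 n, Measurable (X n i))
    (s r : ℕ → ℕ) (V V' : ℕ → ℕ → 𝓖 → Ω → ℝ) (c : 𝓖 → 𝓖 → ℝ)
    (hp_pos : ∀ᶠ n in atTop, 0 < BlockArray.blockProb μ V n)
    (hp_zero : Tendsto (BlockArray.blockProb μ V) atTop (𝓝 0))
    (hA : BlockArray.CondA μ X s r)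
    (hV : BlockArray.CondV μ X s r V V')
    (hMV : BlockArray.CondMV μ s r V')
    (hMX : ∃ k : ℕ, 2 ≤ k ∧ BlockArray.CondMX μ X s r k)
    (hΔ : BlockArray.CondDelta μ s r V V')
    (hL : BlockArray.CondL μ s r V)
    (hD0 : BlockArray.CondD0 μ s r V)
    (hC : BlockArray.CondC μ s r V c) :
    ∃ (Ω' : Type w) (_ : MeasurableSpace Ω') (P : Measure Ω') (_ : IsProbabilityMeasure P)
      (Z : 𝓖 → Ω' → ℝ),
      IsGaussianProcess Z P ∧ (∀ g, ∫ ω, Z g ω ∂P = 0) ∧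
      (∀ g h, cov[Z g, Z h; P] = c g h) ∧
      ∀ I : Finset 𝓖, TendstoInDistribution
        (fun (n : ℕ) (ω : Ω) (g : I) => BlockArray.empProcess μ s r V n g ω) atTop
        (fun (ω : Ω') (g : I) => Z g ω) (fun _ => μ) P := by
  classical
  obtain ⟨k, hk, hMX⟩ := hMX
  obtain ⟨P, hP, hgauss, hmean, hcov, hlaw⟩ :=
    BlockArray.exists_isGaussianProcess fun I => hC.posSemidef I
  refine ⟨𝓖 → ℝ, inferInstance, P, hP, fun g ω => ω g, hgauss, hmean, hcov, fun I => ?_⟩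
  -- Characteristic functions need an inner product, so convergence is proved in Euclidean space and
  -- carried back at the end by the continuous map `WithLp.ofLp`.
  have hm : ∀ n, Measurable fun (ω : Ω) =>
      WithLp.toLp 2 fun g : I => BlockArray.empProcess μ s r V n g ω := fun n => by
    refine (MeasurableEquiv.toLp 2 (I → ℝ)).measurable.comp (measurable_pi_iff.2 fun g => ?_)
    exact (Finset.measurable_fun_sum _ fun i hi => (BlockArray.measurable_block hX hA hV
      (Finset.mem_Icc.1 hi) g).sub_const _).const_mul _
  have hmZ : Measurable fun ω : 𝓖 → ℝ => WithLp.toLp 2 fun g : I => ω g :=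
    (MeasurableEquiv.toLp 2 (I → ℝ)).measurable.comp (measurable_pi_iff.2 fun g => measurable_pi_apply _)
  have hlawZ : P.map (fun ω : 𝓖 → ℝ => WithLp.toLp 2 fun g : I => ω g)
      = multivariateGaussian 0 (BlockArray.kernelMatrix c I) := by
    have h1 := Measure.map_map (μ := P) (MeasurableEquiv.toLp 2 (I → ℝ)).measurable
      (Finset.measurable_restrict (X := fun _ : 𝓖 => ℝ) I)
    rw [hlaw I] at h1
    exact h1.symm.trans (MeasurableEquiv.map_map_symm _)
  have key : TendstoInDistribution
      (fun (n : ℕ) (ω : Ω) => WithLp.toLp 2 fun g : I => BlockArray.empProcess μ s r V n g ω) atTop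
      (fun ω : 𝓖 → ℝ => WithLp.toLp 2 fun g : I => ω g) (fun _ => μ) P := by
    refine ⟨fun n => (hm n).aemeasurable, hmZ.aemeasurable,
      ProbabilityMeasure.tendsto_of_tendsto_charFun fun t => ?_⟩
    have h1 := BlockArray.tendsto_integral_expI_sum_empProcess hX hp_pos hA hV hMV hk hMX hΔ hL hC
      I (WithLp.ofLp t)
    simp only [ProbabilityMeasure.coe_mk]
    have h2 : charFun (P.map (fun ω : 𝓖 → ℝ => WithLp.toLp 2 fun g : I => ω g)) t
        = Complex.exp ((-((∑ g : I, ∑ h : I, t g * t h * c g h) / 2) : ℝ) : ℂ) := by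
      rw [hlawZ, charFun_multivariateGaussian (hC.posSemidef I)]
      congr 1
      simp only [inner_zero_right, Complex.ofReal_zero, zero_mul, zero_sub, dotProduct,
        Matrix.mulVec, BlockArray.kernelMatrix, Matrix.of_apply, Finset.mul_sum]
      push_cast
      congr 2
      refine Finset.sum_congr rfl fun g _ => Finset.sum_congr rfl fun h _ => ?_
      ring
    rw [h2]
    refine h1.congr fun n => ?_
    rw [charFun_apply, integral_map (hm n).aemeasurable (by fun_prop)]
    refine integral_congr_ae (ae_of_all _ fun ω => ?_)
    simp only [BlockArray.expI, PiLp.inner_apply]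
    simp
  exact key.continuous_comp (g := WithLp.ofLp) (PiLp.continuous_ofLp 2 _)
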